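/- Let $(h(n))_{n\ge 0}$ and $(b(n))_{n\ge 0}$ be real sequences with $b(0)=0$ and $b(n)>0$ for $n\ge 1$. Let $\mathcal F=\ell^2(\mathbb N,\mathbb C)$ be the Fock space with standard orthonormal basis $|n\rangle$, $n\ge 0$ (inner products are conjugate-linear in the first argument). Assume that the operator $$\mathbf H_I|n\rangle=h(n)|n\rangle+b(n)|n-1\rangle+b(n+1)|n+1\rangle$$ on the finite linear combinations of the $|n\rangle$ has deficiency indices $(0,0)$, and denote its closure, which is self-adjoint, again by $\mathbf H_I$. Let $E$ be the spectral measure of $\mathbf H_I$, let $d\sigma(\omega)=\langle 0|dE(\omega)\,0\rangle$ and $e^{-i\mathbf H_It}=\int e^{-i\omega t}\,dE(\omega)$. Assume that the absolute moments $|\mu|_n=\int|\omega|^n\,d\sigma(\omega)$ are finite for all $n\ge 0$ and that $\limsup_{n\to\infty}\sqrt[n]{|\mu|_n}/n<+\infty$. Let $\{P_n\}$ be the orthonormal polynomials obtained by the Gram–Schmidt process from $\{\omega^n\}$ in $L^2(\mathbb R,d\sigma)$, let $\mathbf U|\psi\rangle=\sum_n\langle n|\psi\rangle P_n$, and let $\widehat\sigma(t)=\int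 e^{-it\omega}\,d\sigma(\omega)$ for $t\in\mathbb R$. Then there is a largest open connected set containing $\mathbb R$ and invariant under all translations $z\mapsto z+t$, $t\in\mathbb R$, to which $\widehat\sigma$ extends holomorphically; it is a strip $\{2r<\operatorname{Im}z<2s\}$ with $-\infty\le r<0<s\le+\infty$. Denote the extension by $\widehat\sigma$ too, and put $\Sigma=\{r<\operatorname{Im}z<s\}$, an open set. For $z\in\Sigma$ the function $e^{-iz\,\cdot}$ lies in $L^2(\mathbb R,d\sigma)$, and the coherent state $$|z\rangle=\sum_{n\ge0}\widehat\sigma_n(z)\,|n\rangle,\qquad \widehat\sigma_n(z)=\int e^{-iz\omega}P_n(\omega)\,d\sigma(\omega),$$ is nonzero and satisfies $\mathbf U|z\rangle=e^{-iz\,\cdot}$. For $z\in\Sigma$ the number $\widehat\sigma(z-\bar z)$ is real and positive, the function $\log\widehat\sigma(z-\bar z)$ is smooth on $\Sigma$, and the two-form $$\Omega=i\,\frac{\partial^2}{\partial\bar z\,\partial z}\bigl(\log\widehat\sigma(z-\bar z)\bigr)\,d\bar z\wedge dz$$ is nondegenerate on $\Sigma$. Let $\Omega_{FS}$ be the Fubini–Study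 form on the complex projective Hilbert space $\mathbb{CP}(\mathcal F)$, with the sign and normalization $\Omega_{FS}=i\,\bar\partial\partial\log\|w\|^2$ in the affine charts $[v]\mapsto w=v/\langle e|v\rangle$, that is, $$\Omega_{FS}(\xi,\eta)=-2\operatorname{Im}\left(\frac{\langle\xi|\eta\rangle}{\|w\|^2}-\frac{\langle\xi|w\rangle\langle w|\eta\rangle}{\|w\|^4}\right).$$ Let $\mathcal K:\Sigma\to\mathbb{CP}(\mathcal F)$, $\mathcal K(z)=\mathbb C|z\rangle$. Then: 1. $\mathcal K$ is holomorphic; 2. $\mathcal K$ is symplectic: $\mathcal K^*\Omega_{FS}=\Omega$; 3. for every $t\in\mathbb R$ the operator $e^{-i\mathbf H_It}$ is injective, hence acts on $\mathbb{CP}(\mathcal F)$, the translation $T_tz=z+t$ maps $\Sigma$ into itself, and $\mathcal K(T_tz)=e^{-i\mathbf H_It}\,\mathcal K(z)$ for all $z\in\Sigma$. -/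

import Mathlib

open MeasureTheory Filter Topology
open scoped ENNReal ComplexConjugate LinearAlgebra.Projectivization

noncomputable section

namespace SpectralCoherent

/-! ### The Fock space and the Jacobi operator -/

/-- The Fock space `ℱ = ℓ²(ℕ, ℂ)`. -/
abbrev Fock : Type := lp (fun _ : ℕ => ℂ) 2

/-- The Fock basis vector `|n⟩`. -/
def ket (n : ℕ) : Fock := lp.single 2 n (1 : ℂ)

lemma ket_zero_ne_zero : ket 0 ≠ 0 := by
  intro h
  have h2 := congrArg (fun f : Fock => f 0) h
  simp [ket] at h2

/-- The image of `|n⟩` under `H_I`. The value `b 0` is always zero in use, so that the truncated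
subtraction `0 - 1` is harmless. -/
def jacobiKet (h b : ℕ → ℝ) (n : ℕ) : Fock :=
  (h n : ℂ) • ket n + (b n : ℂ) • ket (n - 1) + (b (n + 1) : ℂ) • ket (n + 1)

/-- The finite linear combinations of the Fock basis. -/
def finiteSpan : Submodule ℂ Fock where
  carrier := {ψ | {n | ψ n ≠ 0}.Finite}
  add_mem' := by
    intro φ ψ hφ hψ
    refine (hφ.union hψ).subset fun n hn => ?_
    by_contra hc
    simp only [Set.mem_union, Set.mem_ofPred_eq, not_or, not_not] at hc
    apply hn
    simp [hc.1, hc.2]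
  zero_mem' := by simp
  smul_mem' := by
    intro c ψ hψ
    refine Set.Finite.subset hψ fun n hn => ?_
    simp only [Set.mem_ofPred_eq, lp.coeFn_smul, Pi.smul_apply, smul_eq_mul] at hn ⊢
    exact right_ne_zero_of_mul hn

lemma summable_jacobi (h b : ℕ → ℝ) (ψ : finiteSpan) :
    Summable fun n => (ψ : Fock) n • jacobiKet h b n := by
  refine summable_of_hasFiniteSupport (Set.Finite.subset ψ.2 fun n hn => ?_)
  simp only [Function.mem_support] at hn
  exact left_ne_zero_of_smul hn

/-- The three-diagonal operator
`|n⟩ ↦ h(n)|n⟩ + b(n)|n-1⟩ + b(n+1)|n+1⟩` on the finite linear combinations of the Fock basis. -/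
def jacobiOp (h b : ℕ → ℝ) : Fock →ₗ.[ℂ] Fock where
  domain := finiteSpan
  toFun :=
    { toFun := fun ψ => ∑' n, (ψ : Fock) n • jacobiKet h b n
      map_add' := by
        intro φ ψ
        rw [← (summable_jacobi h b φ).tsum_add (summable_jacobi h b ψ)]
        simp [add_smul]
      map_smul' := by
        intro c ψ
        simp only [RingHom.id_apply]
        rw [← (summable_jacobi h b ψ).tsum_const_smul]
        simp [mul_smul] }

section Hilbert

variable {E : Type*} [NormedAddCommGroup E] [InnerProductSpace ℂ E]

/-- The deficiency space `ker (A* - z)` of a densely defined operator `A`. -/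
def deficiencySpace (A : E →ₗ.[ℂ] E) (z : ℂ) : Submodule ℂ E where
  carrier := {ψ | ∀ φ : A.domain, inner ℂ (A φ) ψ = z * inner ℂ (φ : E) ψ}
  add_mem' := by
    intro x y hx hy φ
    rw [inner_add_right, inner_add_right, hx φ, hy φ, mul_add]
  zero_mem' := by intro φ; simp
  smul_mem' := by
    intro c x hx φ
    rw [inner_smul_right, inner_smul_right, hx φ]
    ring

/-- Deficiency indices `(0,0)`. -/
def HasZeroDeficiencyIndices (A : E →ₗ.[ℂ] E) : Prop :=
  deficiencySpace A Complex.I = ⊥ ∧ deficiencySpace A (-Complex.I) = ⊥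

/-! ### Spectral measures -/

variable [CompleteSpace E]

variable (E) in
/-- A projection-valued measure on the Borel sets of the real line. -/
structure ProjMeasure where
  proj : Set ℝ → (E →L[ℂ] E)
  isStarProjection : ∀ B, MeasurableSet B → IsStarProjection (proj B)
  proj_empty : proj ∅ = 0
  proj_univ : proj Set.univ = 1
  proj_inter : ∀ A B, MeasurableSet A → MeasurableSet B → proj (A ∩ B) = proj A * proj B
  hasSum_iUnion : ∀ B : ℕ → Set ℝ, (∀ n, MeasurableSet (B n)) →
    Pairwise (Function.onFun Disjoint B) →
    ∀ ψ : E, HasSum (fun n => proj (B n) ψ) (proj (⋃ n, B n) ψ)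

lemma re_inner_proj_nonneg {T : E →L[ℂ] E} (hT : IsStarProjection T) (ψ : E) :
    0 ≤ (inner ℂ ψ (T ψ)).re := by
  have h1 : inner ℂ ψ (T ψ) = inner ℂ (T ψ) (T ψ) := by
    conv_lhs => rw [← hT.isIdempotentElem.eq]
    have h2 : ContinuousLinearMap.adjoint T = T := hT.isSelfAdjoint
    rw [mul_apply_eq_comp, ← ContinuousLinearMap.adjoint_inner_left, h2]
  rw [h1]
  exact inner_self_nonneg (𝕜 := ℂ)

/-- The finite measure `B ↦ ⟨ψ| E(B) ψ⟩`. -/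
def ProjMeasure.measure (P : ProjMeasure E) (ψ : E) : Measure ℝ :=
  Measure.ofMeasurable (fun B _ => ENNReal.ofReal (inner ℂ ψ (P.proj B ψ)).re)
    (by simp [P.proj_empty])
    (by
      intro B hB hd
      have h1 : HasSum (fun n => (inner ℂ ψ (P.proj (B n) ψ)).re)
          (inner ℂ ψ (P.proj (⋃ n, B n) ψ)).re :=
        Complex.hasSum_re ((P.hasSum_iUnion B hB hd ψ).mapL (innerSL ℂ ψ))
      rw [← h1.tsum_eq, ENNReal.ofReal_tsum_of_nonneg _ h1.summable]
      exact fun n => re_inner_proj_nonneg (P.isStarProjection _ (hB n)) ψ)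

/-- `P` is the spectral measure of the operator `A`, that is `A = ∫ ω dE(ω)`: the domain of `A`
consists of the `ψ` with `∫ ω² ⟨ψ|dE(ω)ψ⟩ < ∞`, and `⟨ψ|Aψ⟩ = ∫ ω ⟨ψ|dE(ω)ψ⟩` on the domain. -/
def IsSpectralMeasureOf (P : ProjMeasure E) (A : E →ₗ.[ℂ] E) : Prop :=
  (∀ ψ : E, ψ ∈ A.domain ↔ ∫⁻ ω, ‖ω‖ₑ ^ 2 ∂(P.measure ψ) < ∞) ∧
  ∀ ψ : A.domain, inner ℂ (ψ : E) (A ψ) = ((∫ ω, ω ∂(P.measure (ψ : E)) : ℝ) : ℂ)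

/-- The bounded operator `T` equals `∫ f(ω) dE(ω)`. -/
def ProjMeasure.IsIntegral (P : ProjMeasure E) (f : ℝ → ℂ) (T : E →L[ℂ] E) : Prop :=
  ∀ ψ : E, Integrable f (P.measure ψ) ∧ inner ℂ ψ (T ψ) = ∫ ω, f ω ∂(P.measure ψ)

open Classical in
/-- The operator `∫ f(ω) dE(ω)` (and `0` if it is not a bounded operator). -/
def ProjMeasure.integral (P : ProjMeasure E) (f : ℝ → ℂ) : E →L[ℂ] E :=
  if h : ∃ T, P.IsIntegral f T then h.choose else 0

/-- For the spectral measure of `H`, the operator `e^{-iHt}`. -/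
def ProjMeasure.evolution (P : ProjMeasure E) (t : ℝ) : E →L[ℂ] E :=
  P.integral fun ω => Complex.exp (-Complex.I * t * ω)

end Hilbert

/-! ### The characteristic function and the maximal strip -/

/-- The absolute moments `∫ |ω|ⁿ dσ(ω)`. -/
def absMoment (σ : Measure ℝ) (n : ℕ) : ℝ≥0∞ := ∫⁻ ω, ‖ω‖ₑ ^ n ∂σ

/-- The characteristic function `σ̂(t) = ∫ e^{-itω} dσ(ω)`. -/
def charFn (σ : Measure ℝ) (t : ℝ) : ℂ := ∫ ω, Complex.exp (-Complex.I * t * ω) ∂σ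

/-- `f` is a holomorphic extension of `σ̂` to `S`. -/
def IsHolExtension (σ : Measure ℝ) (S : Set ℂ) (f : ℂ → ℂ) : Prop :=
  DifferentiableOn ℂ f S ∧ ∀ t : ℝ, f t = charFn σ t

/-- `S` is an open connected set that contains the real line and is invariant under the
translations `z ↦ z + t`, and `σ̂` extends holomorphically to it. -/
def IsHolStrip (σ : Measure ℝ) (S : Set ℂ) : Prop :=
  IsOpen S ∧ IsConnected S ∧ (∀ t : ℝ, (t : ℂ) ∈ S) ∧ (∀ z ∈ S, ∀ t : ℝ, z + t ∈ S) ∧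
    ∃ f, IsHolExtension σ S f

/-- The maximal strip, written `{z | 2r < Im z < 2s}`. -/
def maxStrip (σ : Measure ℝ) : Set ℂ := ⋃₀ {S | IsHolStrip σ S}

/-- The half strip `Σ = {z | r < Im z < s}`. -/
def halfStrip (σ : Measure ℝ) : Set ℂ := {z | 2 * z ∈ maxStrip σ}

open Classical in
/-- The holomorphic extension of `σ̂` to the maximal strip (it is unique there). -/
def charExt (σ : Measure ℝ) : ℂ → ℂ :=
  if h : ∃ f, IsHolExtension σ (maxStrip σ) f then h.choose else 0

/-! ### Orthonormal polynomials and coherent states -/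

open Classical in
/-- The monomial `ωⁿ` as an element of `L²(ℝ, dσ)`. -/
def monomialL2 (σ : Measure ℝ) (n : ℕ) : Lp ℂ 2 σ :=
  if h : MemLp (fun ω : ℝ => (ω : ℂ) ^ n) 2 σ then h.toLp else 0

/-- The orthonormal polynomials `P_n`, obtained by the Gram-Schmidt process. -/
def orthoPoly (σ : Measure ℝ) (n : ℕ) : Lp ℂ 2 σ :=
  InnerProductSpace.gramSchmidtNormed ℂ (monomialL2 σ) n

/-- The map `U|ψ⟩ = ∑ ⟨n|ψ⟩ P_n` from the Fock space to `L²(ℝ, dσ)`. -/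
def toL2 (σ : Measure ℝ) (ψ : Fock) : Lp ℂ 2 σ := ∑' n, ψ n • orthoPoly σ n

open Classical in
/-- The function `e^{-iz·}` as an element of `L²(ℝ, dσ)`. -/
def expL2 (σ : Measure ℝ) (z : ℂ) : Lp ℂ 2 σ :=
  if h : MemLp (fun ω : ℝ => Complex.exp (-Complex.I * z * ω)) 2 σ then h.toLp else 0

/-- The coefficient `σ̂_n(z) = ∫ e^{-izω} P_n(ω) dσ(ω)`. -/
def coherentCoeff (σ : Measure ℝ) (n : ℕ) (z : ℂ) : ℂ := inner ℂ (orthoPoly σ n) (expL2 σ z)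

/-- The coherent states map `K(z) = |z⟩ = ∑ σ̂_n(z)|n⟩`. -/
def coherent (σ : Measure ℝ) (z : ℂ) : Fock := ∑' n, coherentCoeff σ n z • ket n

open Classical in
/-- The projectivized coherent states map `𝒦(z) = ℂ|z⟩` (with an arbitrary value if `|z⟩ = 0`). -/
def coherentProj (σ : Measure ℝ) (z : ℂ) : ℙ ℂ Fock :=
  if h : coherent σ z ≠ 0 then Projectivization.mk ℂ (coherent σ z) h
  else Projectivization.mk ℂ (ket 0) ket_zero_ne_zero

/-! ### The projective Hilbert space -/

section Projective

variable {E : Type*} [NormedAddCommGroup E] [InnerProductSpace ℂ E]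

/-- The domain `{[v] | ⟨e|v⟩ ≠ 0}` of the affine chart of `ℂP(E)` given by `e`. -/
def chartDomain (e : E) : Set (ℙ ℂ E) := {p | inner ℂ e p.rep ≠ 0}

/-- The affine chart `[v] ↦ v / ⟨e|v⟩` of `ℂP(E)`, with values in the affine closed hyperplane
`{w | ⟨e|w⟩ = 1}`. -/
def affineChart (e : E) (p : ℙ ℂ E) : E := (inner ℂ e p.rep)⁻¹ • p.rep

lemma affineChart_mk (e v : E) (hv : v ≠ 0) :
    affineChart e (Projectivization.mk ℂ v hv) = (inner ℂ e v)⁻¹ • v := by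
  obtain ⟨a, ha⟩ := Projectivization.exists_smul_eq_mk_rep ℂ v hv
  have ha' : (a : ℂ) • v = (Projectivization.mk ℂ v hv).rep := ha
  rw [affineChart, ← ha', inner_smul_right, smul_smul, mul_inv, mul_comm (a : ℂ)⁻¹, mul_assoc,
    inv_mul_cancel₀ a.ne_zero, mul_one]

lemma mk_mem_chartDomain (e v : E) (hv : v ≠ 0) :
    Projectivization.mk ℂ v hv ∈ chartDomain e ↔ inner ℂ e v ≠ 0 := by
  obtain ⟨a, ha⟩ := Projectivization.exists_smul_eq_mk_rep ℂ v hv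
  have ha' : (a : ℂ) • v = (Projectivization.mk ℂ v hv).rep := ha
  simp only [chartDomain, Set.mem_ofPred_eq]
  rw [← ha', inner_smul_right]
  simp

/-- Holomorphy of a map from the open set `S ⊆ ℂ` to `ℂP(E)`: in every affine chart, preimages of
the chart domain are open and the coordinate expression is holomorphic. -/
def IsHolomorphicToProj (f : ℂ → ℙ ℂ E) (S : Set ℂ) : Prop :=
  ∀ e : E, IsOpen (S ∩ f ⁻¹' chartDomain e) ∧
    DifferentiableOn ℂ (fun z => affineChart e (f z)) (S ∩ f ⁻¹' chartDomain e)

/-- The Fubini-Study form `i ∂̄∂ log ‖w‖²` in affine coordinates, at the point `w` and on the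
tangent vectors `ξ, η`: minus twice the imaginary part of the Fubini-Study Hermitian form
`⟨ξ|η⟩/‖w‖² - ⟨ξ|w⟩⟨w|η⟩/‖w‖⁴`. -/
def fubiniStudy (w ξ η : E) : ℝ :=
  -2 * (inner ℂ ξ η / (‖w‖ : ℂ) ^ 2 - inner ℂ ξ w * inner ℂ w η / (‖w‖ : ℂ) ^ 4).im

/-- The pullback of the Fubini-Study form under `f : ℂ → ℂP(E)` at the point `z`, computed in the
affine chart given by `e`, on the real tangent vectors `u, v ∈ ℂ`. -/
def fubiniStudyPullback (e : E) (f : ℂ → ℙ ℂ E) (z u v : ℂ) : ℝ :=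
  fubiniStudy (affineChart e (f z)) (fderiv ℝ (fun x => affineChart e (f x)) z u)
    (fderiv ℝ (fun x => affineChart e (f x)) z v)

end Projective

/-! ### The symplectic form on the half strip -/

/-- The Wirtinger derivative `∂/∂z`. -/
def wirtinger (f : ℂ → ℂ) (z : ℂ) : ℂ :=
  (fderiv ℝ f z 1 - Complex.I * fderiv ℝ f z Complex.I) / 2

/-- The Wirtinger derivative `∂/∂z̄`. -/
def wirtingerBar (f : ℂ → ℂ) (z : ℂ) : ℂ :=
  (fderiv ℝ f z 1 + Complex.I * fderiv ℝ f z Complex.I) / 2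

/-- The function `log σ̂(z - z̄)`. -/
def potential (σ : Measure ℝ) (z : ℂ) : ℂ := Complex.log (charExt σ (z - conj z))

/-- The two-form `Ω = i ∂²/∂z̄∂z (log σ̂(z - z̄)) dz̄ ∧ dz` at `z`, on the real tangent vectors
`u, v ∈ ℂ`. -/
def omegaForm (σ : Measure ℝ) (z u v : ℂ) : ℂ :=
  Complex.I * wirtingerBar (wirtinger (potential σ)) z * (conj u * v - conj v * u)

end SpectralCoherent

end

noncomputable section

namespace SpectralCoherent

/-! ### Isometries determined by Gram matrices -/

section Gram

variable {ι E F : Type*} [NormedAddCommGroup E] [InnerProductSpace ℂ E]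
  [NormedAddCommGroup F] [InnerProductSpace ℂ F]

/-! Everything is carried by the isometry `V = P.cyclic (ket 0)` from `L²(σ)` to the Fock space, `f
↦ f(H)|0⟩`. Applying `H` to a vector of degree `n` gives one of degree `n + 1`, with leading
coefficient multiplied by `b (n + 1) > 0`. Hence Gram–Schmidt turns the vectors `Hⁿ|0⟩` into the
kets, and since isometries commute with Gram–Schmidt, `V P_n = |n⟩` (`cyclic_orthoPoly`). So `V` is
inverse to `U`, `|z⟩ = V(e^{-iz·})`, and evolution becomes multiplication by `e^{-itω}`.

The maximal strip consists of the `z` with `Im z` in the interior `I` of the set of `y` for which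
`e^{yω}` is integrable. The moment growth puts `0` in `I`. That no extension goes further is a
Landau-type argument (`subset_interior_integrableExpSet`): the Taylor coefficients of an extension
are moments of tilted measures, and the even ones are nonnegative, so convergence of the series
forces integrability.

On the half strip `⟨z|z⟩ = σ̂(z - z̄)` is the moment generating function at `2 Im z`. Both two-forms
are then `-2 Im(ūv)` times the second derivative of its logarithm, the variance of `σ` tilted by
`e^{2 Im z ω}`. It is positive because `σ` is not a point mass. -/

lemma norm_linearCombination_eq_of_inner_eq {v : ι → E} {w : ι → F}
    (h : ∀ i j, inner ℂ (v i) (v j) = inner ℂ (w i) (w j)) (c : ι →₀ ℂ) :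
    ‖Finsupp.linearCombination ℂ w c‖ = ‖Finsupp.linearCombination ℂ v c‖ := by
  have h1 : inner ℂ (Finsupp.linearCombination ℂ w c) (Finsupp.linearCombination ℂ w c) =
      inner ℂ (Finsupp.linearCombination ℂ v c) (Finsupp.linearCombination ℂ v c) := by
    simp only [Finsupp.linearCombination_apply, Finsupp.sum, sum_inner, inner_sum,
      inner_smul_left, inner_smul_right, h]
  rw [@norm_eq_sqrt_re_inner ℂ, @norm_eq_sqrt_re_inner ℂ, h1]

/-- Equal Gram matrices make `∑ cᵢ vᵢ ↦ ∑ cᵢ wᵢ` well defined and norm-preserving; density and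
completeness extend it. -/
lemma exists_linearIsometry_of_inner_eq [CompleteSpace F] (v : ι → E) (w : ι → F)
    (h : ∀ i j, inner ℂ (v i) (v j) = inner ℂ (w i) (w j))
    (hv : Dense (Submodule.span ℂ (Set.range v) : Set E)) :
    ∃ V : E →ₗᵢ[ℂ] F, ∀ i, V (v i) = w i := by
  have hd : DenseRange (Finsupp.linearCombination ℂ v) := by
    rw [DenseRange, ← LinearMap.coe_range, Finsupp.range_linearCombination]
    exact hv
  have hn := norm_linearCombination_eq_of_inner_eq h
  have he := fun x => LinearMap.extendOfNorm_eq hd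
    (f := Finsupp.linearCombination ℂ w) ⟨1, fun x => by rw [hn x, one_mul]⟩ x
  refine ⟨⟨((Finsupp.linearCombination ℂ w).extendOfNorm (Finsupp.linearCombination ℂ v)), ?_⟩, ?_⟩
  · intro x
    refine hd.induction (P := fun x => ‖_‖ = ‖x‖) ?_ (isClosed_eq (by
      simp only [ContinuousLinearMap.coe_coe]; fun_prop) continuous_norm) x
    rintro _ ⟨c, rfl⟩
    rw [ContinuousLinearMap.coe_coe, he, hn]
  · intro i
    have := he (Finsupp.single i 1)
    simpa using this

/-- Complex polarization with `φ + ψ` and `φ + iψ`, for an operator defined only on a subspace. -/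
lemma inner_eq_zero_of_forall_inner_self {D : Submodule ℂ E} (S : D →ₗ[ℂ] E)
    (h : ∀ ψ : D, inner ℂ (ψ : E) (S ψ) = 0) (φ ψ : D) : inner ℂ (φ : E) (S ψ) = 0 := by
  have h1 := h (φ + ψ)
  have h2 := h (φ + Complex.I • ψ)
  simp only [Submodule.coe_add, Submodule.coe_smul, map_add, map_smul, inner_add_left,
    inner_add_right, inner_smul_left, inner_smul_right, h, Complex.conj_I] at h1 h2
  have h3 := Complex.I_mul_I
  linear_combination (1 / 2) * h1 - (Complex.I / 2) * h2 +
    (1 / 2 * (inner ℂ (φ : E) (S ψ) - inner ℂ (ψ : E) (S φ))) * h3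

end Gram

/-! ### The functional calculus of a projection-valued measure -/

namespace ProjMeasure

variable {E : Type*} [NormedAddCommGroup E] [InnerProductSpace ℂ E] [CompleteSpace E]
  (P : ProjMeasure E)

lemma inner_proj_left {B : Set ℝ} (hB : MeasurableSet B) (φ ψ : E) :
    inner ℂ (P.proj B φ) ψ = inner ℂ φ (P.proj B ψ) := by
  have h2 : ContinuousLinearMap.adjoint (P.proj B) = P.proj B :=
    (P.isStarProjection B hB).isSelfAdjoint
  rw [← ContinuousLinearMap.adjoint_inner_right, h2]

lemma inner_proj_proj {A B : Set ℝ} (hA : MeasurableSet A) (hB : MeasurableSet B) (φ ψ : E) :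
    inner ℂ (P.proj A φ) (P.proj B ψ) = inner ℂ φ (P.proj (A ∩ B) ψ) := by
  rw [inner_proj_left P hA, P.proj_inter A B hA hB, mul_apply_eq_comp]

lemma inner_proj_self {B : Set ℝ} (hB : MeasurableSet B) (ψ : E) :
    inner ℂ ψ (P.proj B ψ) = ((‖P.proj B ψ‖ ^ 2 : ℝ) : ℂ) := by
  have := P.inner_proj_proj hB hB ψ ψ
  rw [Set.inter_self] at this
  rw [← this, inner_self_eq_norm_sq_to_K]
  norm_cast

lemma measure_apply {B : Set ℝ} (hB : MeasurableSet B) (ψ : E) :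
    P.measure ψ B = ENNReal.ofReal (‖P.proj B ψ‖ ^ 2) := by
  rw [ProjMeasure.measure, Measure.ofMeasurable_apply _ hB, P.inner_proj_self hB, Complex.ofReal_re]

lemma measure_univ (ψ : E) : P.measure ψ Set.univ = ENNReal.ofReal (‖ψ‖ ^ 2) := by
  rw [P.measure_apply MeasurableSet.univ, P.proj_univ]
  rfl

instance isFiniteMeasure_measure (ψ : E) : IsFiniteMeasure (P.measure ψ) :=
  ⟨by rw [P.measure_univ]; exact ENNReal.ofReal_lt_top⟩

lemma measureReal_apply {B : Set ℝ} (hB : MeasurableSet B) (ψ : E) :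
    (P.measure ψ).real B = ‖P.proj B ψ‖ ^ 2 := by
  rw [Measure.real, P.measure_apply hB, ENNReal.toReal_ofReal (by positivity)]

lemma indicatorConstLp_eq_smul_one {μ : Measure ℝ} {s : Set ℝ} (hs : MeasurableSet s)
    (hμ : μ s ≠ ∞) (c : ℂ) :
    indicatorConstLp 2 hs hμ c = c • indicatorConstLp 2 hs hμ (1 : ℂ) := by
  rw [indicatorConstLp, indicatorConstLp, ← MemLp.toLp_const_smul]
  congr 1
  ext ω
  by_cases h : ω ∈ s <;> simp [h]

lemma dense_span_indicatorConstLp (μ : Measure ℝ) [IsFiniteMeasure μ] :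
    Dense (Submodule.span ℂ (Set.range fun B : {B : Set ℝ // MeasurableSet B} =>
      indicatorConstLp 2 B.2 (measure_ne_top μ B.1) (1 : ℂ)) : Set (Lp ℂ 2 μ)) := by
  intro f
  set S := Submodule.span ℂ (Set.range fun B : {B : Set ℝ // MeasurableSet B} =>
      indicatorConstLp 2 B.2 (measure_ne_top μ B.1) (1 : ℂ))
  refine Lp.induction (by norm_num) (motive := fun f => f ∈ closure (S : Set (Lp ℂ 2 μ)))
    ?_ ?_ isClosed_closure f
  · intro c s hs hμ
    refine subset_closure ?_
    rw [Lp.simpleFunc.coe_indicatorConst, indicatorConstLp_eq_smul_one hs]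
    exact S.smul_mem _ (Submodule.subset_span ⟨⟨s, hs⟩, rfl⟩)
  · intro f g hf hg _ h1 h2
    exact S.topologicalClosure.add_mem h1 h2

/-- The Gram matrices agree: `⟨E(A)ψ|E(B)ψ⟩ = μ_ψ(A ∩ B)`, which is also the `L²` product of the
indicators of `A` and `B`. -/
lemma exists_cyclic (ψ : E) : ∃ V : Lp ℂ 2 (P.measure ψ) →ₗᵢ[ℂ] E,
    ∀ B : {B : Set ℝ // MeasurableSet B},
      V (indicatorConstLp 2 B.2 (measure_ne_top _ B.1) (1 : ℂ)) = P.proj B ψ := by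
  refine exists_linearIsometry_of_inner_eq _ _ ?_ (dense_span_indicatorConstLp _)
  intro A B
  rw [P.inner_proj_proj A.2 B.2, P.inner_proj_self (A.2.inter B.2), ← P.measureReal_apply
    (A.2.inter B.2), L2.inner_indicatorConstLp_indicatorConstLp]
  simp

/-- The isometry `f ↦ f(H)ψ` of `L²(μ_ψ)` onto the cyclic subspace of `ψ`. -/
def cyclic (ψ : E) : Lp ℂ 2 (P.measure ψ) →ₗᵢ[ℂ] E := (P.exists_cyclic ψ).choose

lemma cyclic_indicatorConstLp {B : Set ℝ} (hB : MeasurableSet B) (ψ : E) :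
    P.cyclic ψ (indicatorConstLp 2 hB (measure_ne_top _ B) (1 : ℂ)) = P.proj B ψ :=
  (P.exists_cyclic ψ).choose_spec ⟨B, hB⟩

open Classical in
/-- The vector `f(H)ψ = ∫ f(ω) dE(ω) ψ`, for `f` in `L²(μ_ψ)`. -/
def fapply (f : ℝ → ℂ) (ψ : E) : E :=
  if h : MemLp f 2 (P.measure ψ) then P.cyclic ψ h.toLp else 0

variable {P}

lemma fapply_of_memLp {f : ℝ → ℂ} {ψ : E} (h : MemLp f 2 (P.measure ψ)) :
    P.fapply f ψ = P.cyclic ψ h.toLp := dif_pos h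

lemma fapply_coe {ψ : E} (f : Lp ℂ 2 (P.measure ψ)) : P.fapply f ψ = P.cyclic ψ f := by
  rw [fapply_of_memLp (Lp.memLp f), Lp.toLp_coeFn]

lemma norm_fapply {f : ℝ → ℂ} {ψ : E} (h : MemLp f 2 (P.measure ψ)) :
    ‖P.fapply f ψ‖ = (eLpNorm f 2 (P.measure ψ)).toReal := by
  rw [fapply_of_memLp h, LinearIsometry.norm_map, Lp.norm_toLp]

lemma fapply_congr_ae {f g : ℝ → ℂ} {ψ : E} (h : f =ᵐ[P.measure ψ] g) :
    P.fapply f ψ = P.fapply g ψ := by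
  by_cases hf : MemLp f 2 (P.measure ψ)
  · rw [fapply_of_memLp hf, fapply_of_memLp ((memLp_congr_ae h).1 hf)]
    congr 1
    exact (MemLp.toLp_eq_toLp_iff _ _).2 h
  · rw [fapply, fapply, dif_neg hf, dif_neg (fun hg => hf ((memLp_congr_ae h).2 hg))]

lemma fapply_add {f g : ℝ → ℂ} {ψ : E} (hf : MemLp f 2 (P.measure ψ))
    (hg : MemLp g 2 (P.measure ψ)) : P.fapply (f + g) ψ = P.fapply f ψ + P.fapply g ψ := by
  rw [fapply_of_memLp hf, fapply_of_memLp hg, fapply_of_memLp (hf.add hg), MemLp.toLp_add, map_add]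

lemma fapply_sub {f g : ℝ → ℂ} {ψ : E} (hf : MemLp f 2 (P.measure ψ))
    (hg : MemLp g 2 (P.measure ψ)) : P.fapply (f - g) ψ = P.fapply f ψ - P.fapply g ψ := by
  rw [fapply_of_memLp hf, fapply_of_memLp hg, fapply_of_memLp (hf.sub hg), MemLp.toLp_sub, map_sub]

lemma fapply_indicator {B : Set ℝ} (hB : MeasurableSet B) (c : ℂ) (ψ : E) :
    P.fapply (B.indicator fun _ => c) ψ = c • P.proj B ψ := by
  rw [fapply_of_memLp (memLp_indicator_const 2 hB c (Or.inr (measure_ne_top _ B))),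
    ← cyclic_indicatorConstLp P hB, ← map_smul, ← indicatorConstLp_eq_smul_one]
  rfl

lemma fapply_one (ψ : E) : P.fapply (fun _ => 1) ψ = ψ := by
  have := fapply_indicator (P := P) MeasurableSet.univ 1 ψ
  rw [Set.indicator_univ, P.proj_univ, one_smul] at this
  exact this

lemma inner_fapply_fapply {f g : ℝ → ℂ} {ψ : E} (hf : MemLp f 2 (P.measure ψ))
    (hg : MemLp g 2 (P.measure ψ)) :
    inner ℂ (P.fapply f ψ) (P.fapply g ψ) = ∫ ω, conj (f ω) * g ω ∂(P.measure ψ) := by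
  rw [fapply_of_memLp hf, fapply_of_memLp hg, LinearIsometry.inner_map_map, L2.inner_def]
  refine integral_congr_ae ?_
  filter_upwards [hf.coeFn_toLp, hg.coeFn_toLp] with ω h1 h2
  rw [h1, h2, RCLike.inner_apply', ]

lemma inner_fapply_self {f : ℝ → ℂ} {ψ : E} (hf : MemLp f 2 (P.measure ψ)) :
    inner ℂ ψ (P.fapply f ψ) = ∫ ω, f ω ∂(P.measure ψ) := by
  have := inner_fapply_fapply (memLp_const (1 : ℂ)) hf
  rw [fapply_one] at this
  simpa using this

/-- Linearity in `ψ` involves several spectral measures; a common dominating `μ` supplies one `L²`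
space on which approximation can be done. -/
lemma continuous_fapply_of_le {μ : Measure ℝ} {ψ : E} {K : ℝ≥0∞} (hK : K ≠ ∞)
    (h : P.measure ψ ≤ K • μ) : Continuous fun f : Lp ℂ 2 μ => P.fapply f ψ := by
  have hm : ∀ f : ℝ → ℂ, MemLp f 2 μ → MemLp f 2 (P.measure ψ) :=
    fun f hf => hf.of_measure_le_smul hK h
  have hC : K ^ (1 / (2 : ℝ≥0∞).toReal) ≠ ∞ := by
    exact ENNReal.rpow_ne_top_of_nonneg (by norm_num) hK
  refine LipschitzWith.continuous (K := (K ^ (1 / (2 : ℝ≥0∞).toReal)).toNNReal) ?_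
  refine LipschitzWith.of_dist_le_mul fun f g => ?_
  rw [dist_eq_norm, dist_eq_norm, ← fapply_sub (hm _ (Lp.memLp f)) (hm _ (Lp.memLp g)),
    norm_fapply ((hm _ (Lp.memLp f)).sub (hm _ (Lp.memLp g))), Lp.norm_def,
    eLpNorm_congr_ae (Lp.coeFn_sub f g), ENNReal.coe_toNNReal_eq_toReal, ← ENNReal.toReal_mul]
  refine ENNReal.toReal_mono (ENNReal.mul_ne_top hC ?_) ?_
  · exact ((Lp.memLp f).sub (Lp.memLp g)).eLpNorm_ne_top
  · refine (eLpNorm_mono_measure _ h).trans ?_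
    rw [eLpNorm_smul_measure_of_ne_top (by norm_num)]
    simp

/-! ### Square-integrability and domination between spectral measures. -/

lemma sq_eLpNorm_two (f : ℝ → ℂ) (μ : Measure ℝ) :
    eLpNorm f 2 μ ^ 2 = ∫⁻ ω, ‖f ω‖ₑ ^ 2 ∂μ := by
  have := eLpNorm_nnreal_pow_eq_lintegral (f := f) (μ := μ) (p := 2) (by norm_num)
  simpa using this

lemma memLp_two_iff_lintegral {f : ℝ → ℂ} {μ : Measure ℝ} :
    MemLp f 2 μ ↔ AEStronglyMeasurable f μ ∧ ∫⁻ ω, ‖f ω‖ₑ ^ 2 ∂μ < ∞ := by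
  rw [MemLp, ← sq_eLpNorm_two, ENNReal.pow_lt_top_iff]
  simp

lemma memLp_two_add_measure {f : ℝ → ℂ} {μ ν : Measure ℝ} (hμ : MemLp f 2 μ)
    (hν : MemLp f 2 ν) : MemLp f 2 (μ + ν) := by
  rw [memLp_two_iff_lintegral] at *
  refine ⟨hμ.1.add_measure hν.1, ?_⟩
  rw [lintegral_add_measure]
  exact ENNReal.add_lt_top.2 ⟨hμ.2, hν.2⟩

lemma measure_le_self_add (ψ φ : E) : P.measure ψ ≤ (1 : ℝ≥0∞) • (P.measure ψ + P.measure φ) := by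
  rw [one_smul]
  exact Measure.le_add_right le_rfl

lemma measure_smul_add_le (c : ℂ) (ψ φ : E) :
    P.measure (c • ψ + φ) ≤ ENNReal.ofReal (2 * ‖c‖ ^ 2 + 2) • (P.measure ψ + P.measure φ) := by
  refine Measure.le_iff.2 fun B hB => ?_
  rw [Measure.smul_apply, Measure.add_apply, P.measure_apply hB, P.measure_apply hB,
    P.measure_apply hB, smul_eq_mul, ← ENNReal.ofReal_add (by positivity) (by positivity),
    ← ENNReal.ofReal_mul (by positivity)]
  refine ENNReal.ofReal_le_ofReal ?_
  rw [map_add, map_smul]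
  set x := P.proj B ψ
  set y := P.proj B φ
  have h1 : ‖c • x + y‖ ≤ ‖c‖ * ‖x‖ + ‖y‖ := (norm_add_le _ _).trans (by rw [norm_smul])
  have h2 : ‖c • x + y‖ ^ 2 ≤ (‖c‖ * ‖x‖ + ‖y‖) ^ 2 := by gcongr
  nlinarith [sq_nonneg (‖c‖ * ‖x‖ - ‖y‖), sq_nonneg (‖c‖ * ‖y‖), sq_nonneg ‖x‖]

/-- `f(H)` is linear. -/
lemma fapply_smul_add {f : ℝ → ℂ} {ψ φ : E} (c : ℂ) (hψ : MemLp f 2 (P.measure ψ))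
    (hφ : MemLp f 2 (P.measure φ)) :
    P.fapply f (c • ψ + φ) = c • P.fapply f ψ + P.fapply f φ := by
  have hle2 : P.measure φ ≤ (1 : ℝ≥0∞) • (P.measure ψ + P.measure φ) := by
    rw [add_comm]; exact measure_le_self_add φ ψ
  have hle1 := measure_le_self_add (P := P) ψ φ
  have hle3 := measure_smul_add_le (P := P) c ψ φ
  -- Approximation takes place in `L²(μ_ψ + μ_φ)`, which dominates all three measures; on indicators
  -- the claim is the linearity of `E(B)`.
  refine MemLp.induction (p := 2) (by norm_num)
    (motive := fun f => P.fapply f (c • ψ + φ) = c • P.fapply f ψ + P.fapply f φ)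
    ?_ ?_ ?_ ?_ (memLp_two_add_measure hψ hφ)
  · intro a s hs _
    simp only [fapply_indicator hs, map_add, map_smul]
    module
  · intro f g _ hf hg h1 h2
    rw [fapply_add (hf.of_measure_le_smul ENNReal.one_ne_top hle1)
        (hg.of_measure_le_smul ENNReal.one_ne_top hle1),
      fapply_add (hf.of_measure_le_smul ENNReal.one_ne_top hle2)
        (hg.of_measure_le_smul ENNReal.one_ne_top hle2),
      fapply_add (hf.of_measure_le_smul ENNReal.ofReal_ne_top hle3)
        (hg.of_measure_le_smul ENNReal.ofReal_ne_top hle3), h1, h2]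
    module
  · exact isClosed_eq (continuous_fapply_of_le ENNReal.ofReal_ne_top hle3)
      (((continuous_fapply_of_le ENNReal.one_ne_top hle1).const_smul c).add
        (continuous_fapply_of_le ENNReal.one_ne_top hle2))
  · intro f g hfg _ h
    rw [← fapply_congr_ae ((Measure.absolutelyContinuous_of_le_smul hle1).ae_eq hfg),
      ← fapply_congr_ae ((Measure.absolutelyContinuous_of_le_smul hle2).ae_eq hfg),
      ← fapply_congr_ae ((Measure.absolutelyContinuous_of_le_smul hle3).ae_eq hfg), h]

/-- On indicators this is `E(B)E(s) = E(B ∩ s)`, and both sides are continuous in `f`. -/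
lemma proj_fapply {f : ℝ → ℂ} {ψ : E} {B : Set ℝ} (hB : MeasurableSet B)
    (hf : MemLp f 2 (P.measure ψ)) :
    P.proj B (P.fapply f ψ) = P.fapply (B.indicator f) ψ := by
  refine MemLp.induction (p := 2) (by norm_num)
    (motive := fun f => P.proj B (P.fapply f ψ) = P.fapply (B.indicator f) ψ) ?_ ?_ ?_ ?_ hf
  · intro a s hs _
    rw [Set.indicator_indicator, fapply_indicator hs, fapply_indicator (hB.inter hs), map_smul,
      P.proj_inter _ _ hB hs, mul_apply_eq_comp]
  · intro f g _ hf hg h1 h2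
    rw [fapply_add hf hg, Set.indicator_add', fapply_add (hf.indicator hB) (hg.indicator hB),
      map_add, h1, h2]
  · have h1 : Continuous fun f : Lp ℂ 2 (P.measure ψ) => P.fapply f ψ := by
      simp only [fapply_coe]
      fun_prop
    refine isClosed_eq ((P.proj B).continuous.comp h1) ?_
    refine LipschitzWith.continuous (K := 1) (LipschitzWith.of_dist_le_mul fun f g => ?_)
    rw [dist_eq_norm, dist_eq_norm, ← fapply_sub ((Lp.memLp f).indicator hB)
      ((Lp.memLp g).indicator hB), norm_fapply (((Lp.memLp f).indicator hB).sub
      ((Lp.memLp g).indicator hB)), Lp.norm_def, NNReal.coe_one, one_mul,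
      eLpNorm_congr_ae (Lp.coeFn_sub f g), ← Set.indicator_sub']
    exact ENNReal.toReal_mono ((Lp.memLp f).sub (Lp.memLp g)).eLpNorm_ne_top
      (eLpNorm_indicator_le _)
  · intro f g hfg _ h
    rw [← fapply_congr_ae hfg, h]
    refine fapply_congr_ae ?_
    filter_upwards [hfg] with ω hω
    simp only [Set.indicator, hω]

/-- `E(B)` cuts `f` down to `B`, so the mass of `B` is `∫_B |f|² dμ_ψ`. Questions about `f(H)ψ`
thereby reduce to `μ_ψ`. -/
lemma measure_fapply {f : ℝ → ℂ} {ψ : E} (hf : MemLp f 2 (P.measure ψ)) :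
    P.measure (P.fapply f ψ) = (P.measure ψ).withDensity fun ω => ‖f ω‖ₑ ^ 2 := by
  refine Measure.ext fun B hB => ?_
  rw [P.measure_apply hB, proj_fapply hB hf, norm_fapply (hf.indicator hB),
    ← ENNReal.toReal_pow, sq_eLpNorm_two, withDensity_apply _ hB, ENNReal.ofReal_toReal]
  · rw [← lintegral_indicator hB]
    refine lintegral_congr fun ω => ?_
    by_cases h : ω ∈ B <;> simp [h]
  · exact (memLp_two_iff_lintegral.1 (hf.indicator hB)).2.ne

lemma lintegral_measure_fapply {f g : ℝ → ℂ} {ψ : E} (hfm : Measurable f)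
    (hf : MemLp f 2 (P.measure ψ)) :
    ∫⁻ ω, ‖g ω‖ₑ ^ 2 ∂(P.measure (P.fapply f ψ)) = ∫⁻ ω, ‖(g * f) ω‖ₑ ^ 2 ∂(P.measure ψ) := by
  rw [measure_fapply hf, lintegral_withDensity_eq_lintegral_mul_non_measurable _ (by fun_prop)
    (Eventually.of_forall fun ω => by simp)]
  refine lintegral_congr fun ω => ?_
  simp only [Pi.mul_apply, enorm_mul, mul_pow, mul_comm]

lemma ae_measure_fapply_iff {f : ℝ → ℂ} {p : ℝ → Prop} {ψ : E} (hfm : Measurable f)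
    (hf : MemLp f 2 (P.measure ψ)) :
    (∀ᵐ ω ∂(P.measure (P.fapply f ψ)), p ω) ↔ ∀ᵐ ω ∂(P.measure ψ), f ω ≠ 0 → p ω := by
  rw [measure_fapply hf, ae_withDensity_iff (by fun_prop)]
  simp

/-- The measure of `f(H)ψ` does not see the zeros of `f`, but there both products vanish. -/
lemma mul_ae_eq_of_fapply {f g g' : ℝ → ℂ} {ψ : E} (hfm : Measurable f)
    (hf : MemLp f 2 (P.measure ψ)) (h : g =ᵐ[P.measure (P.fapply f ψ)] g') :
    g * f =ᵐ[P.measure ψ] g' * f := by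
  filter_upwards [(ae_measure_fapply_iff hfm hf).1 h] with ω hω
  by_cases h0 : f ω = 0
  · simp [h0]
  · simp [hω h0]

lemma memLp_mul_of_fapply {f g : ℝ → ℂ} {ψ : E} (hfm : Measurable f)
    (hf : MemLp f 2 (P.measure ψ)) (hg : MemLp g 2 (P.measure (P.fapply f ψ))) :
    MemLp (g * f) 2 (P.measure ψ) := by
  rw [memLp_two_iff_lintegral] at hg ⊢
  rw [lintegral_measure_fapply hfm hf] at hg
  refine ⟨?_, hg.2⟩
  obtain ⟨g', h1, h2⟩ := hg.1
  exact ⟨g' * f, h1.mul hfm.stronglyMeasurable, mul_ae_eq_of_fapply hfm hf h2⟩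

/-- `g(H) f(H) ψ = (g f)(H) ψ`. -/
lemma fapply_fapply {f g : ℝ → ℂ} {ψ : E} (hfm : Measurable f)
    (hf : MemLp f 2 (P.measure ψ)) (hg : MemLp g 2 (P.measure (P.fapply f ψ))) :
    P.fapply g (P.fapply f ψ) = P.fapply (g * f) ψ := by
  refine MemLp.induction (p := 2) (by norm_num)
    (motive := fun g => P.fapply g (P.fapply f ψ) = P.fapply (g * f) ψ) ?_ ?_ ?_ ?_ hg
  · intro a s hs _
    rw [fapply_indicator hs, proj_fapply hs hf, fapply_of_memLp (hf.indicator hs), ← map_smul,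
      ← MemLp.toLp_const_smul, ← fapply_of_memLp]
    congr 1
    ext ω
    by_cases h : ω ∈ s <;> simp [h]
  · intro g₁ g₂ _ h1 h2 e1 e2
    rw [fapply_add h1 h2, add_mul, fapply_add (memLp_mul_of_fapply hfm hf h1)
      (memLp_mul_of_fapply hfm hf h2), e1, e2]
  · refine isClosed_eq ?_ ?_
    · simp only [fapply_coe]
      fun_prop
    -- `g ↦ g f` is isometric from `L²(|f|² μ_ψ)` to `L²(μ_ψ)`.
    refine LipschitzWith.continuous (K := 1) (LipschitzWith.of_dist_le_mul fun g₁ g₂ => ?_)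
    have h1 := memLp_mul_of_fapply hfm hf (Lp.memLp g₁)
    have h2 := memLp_mul_of_fapply hfm hf (Lp.memLp g₂)
    rw [dist_eq_norm, dist_eq_norm, ← fapply_sub h1 h2, norm_fapply (h1.sub h2), Lp.norm_def,
      NNReal.coe_one, one_mul, eLpNorm_congr_ae (Lp.coeFn_sub g₁ g₂), ← sub_mul]
    refine le_of_eq (congrArg _ ?_)
    refine (ENNReal.pow_right_strictMono two_ne_zero).injective ?_
    rw [sq_eLpNorm_two, sq_eLpNorm_two,
      lintegral_measure_fapply hfm hf]
  · intro g g' hgg _ h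
    rw [← fapply_congr_ae hgg, h]
    exact fapply_congr_ae (mul_ae_eq_of_fapply hfm hf hgg)

/-! ### The operator of a spectral measure and its evolution -/

lemma IsIntegral.ext {f : ℝ → ℂ} {S T : E →L[ℂ] E} (hS : P.IsIntegral f S)
    (hT : P.IsIntegral f T) : S = T := by
  refine ContinuousLinearMap.coe_injective ((ext_inner_map _ _).1 fun ψ => ?_)
  rw [← inner_conj_symm, ← inner_conj_symm (T.toLinearMap ψ)]
  simp only [ContinuousLinearMap.coe_coe, (hS ψ).2, (hT ψ).2]

/-- The bound makes `f(H)` a bounded operator with the required quadratic form, and this form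
determines the operator chosen in `integral`. -/
lemma integral_apply {f : ℝ → ℂ} (hf : ∀ ψ, MemLp f 2 (P.measure ψ)) {C : ℝ}
    (hC : ∀ ψ, ‖P.fapply f ψ‖ ≤ C * ‖ψ‖) (ψ : E) : P.integral f ψ = P.fapply f ψ := by
  have hadd : ∀ ψ φ : E, P.fapply f (ψ + φ) = P.fapply f ψ + P.fapply f φ := fun ψ φ => by
    simpa using fapply_smul_add (1 : ℂ) (hf ψ) (hf φ)
  have hz : P.fapply f (0 : E) = 0 := by
    simpa using hC 0
  have hsmul : ∀ (c : ℂ) (ψ : E), P.fapply f (c • ψ) = c • P.fapply f ψ := fun c ψ => by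
    simpa [hz] using fapply_smul_add c (hf ψ) (hf 0)
  let T : E →L[ℂ] E := LinearMap.mkContinuous ⟨⟨P.fapply f, hadd⟩, hsmul⟩ C hC
  have hT : P.IsIntegral f T := fun ψ => ⟨(hf ψ).integrable (by norm_num), inner_fapply_self (hf ψ)⟩
  have hex : ∃ T, P.IsIntegral f T := ⟨T, hT⟩
  rw [ProjMeasure.integral, dif_pos hex, hex.choose_spec.ext hT]
  rfl

lemma norm_exp_evolution (t ω : ℝ) : ‖Complex.exp (-Complex.I * t * ω)‖ = 1 := by
  rw [Complex.norm_exp]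
  simp

lemma memLp_exp_evolution (t : ℝ) (μ : Measure ℝ) [IsFiniteMeasure μ] :
    MemLp (fun ω : ℝ => Complex.exp (-Complex.I * t * ω)) 2 μ :=
  MemLp.of_bound (by fun_prop) 1 (Eventually.of_forall fun ω => (norm_exp_evolution t ω).le)

lemma norm_fapply_exp (t : ℝ) (ψ : E) :
    ‖P.fapply (fun ω => Complex.exp (-Complex.I * t * ω)) ψ‖ = ‖ψ‖ := by
  conv_rhs => rw [← fapply_one (P := P) ψ]
  rw [norm_fapply (memLp_exp_evolution t _), norm_fapply (memLp_const _)]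
  congr 1
  refine eLpNorm_congr_norm_ae (Eventually.of_forall fun ω => ?_)
  rw [norm_exp_evolution, norm_one]

lemma evolution_apply (t : ℝ) (ψ : E) :
    P.evolution t ψ = P.fapply (fun ω => Complex.exp (-Complex.I * t * ω)) ψ :=
  integral_apply (fun ψ => memLp_exp_evolution t _) (C := 1)
    (fun ψ => by rw [norm_fapply_exp, one_mul]) ψ

lemma evolution_injective (t : ℝ) : Function.Injective (P.evolution t).toLinearMap := by
  refine (injective_iff_map_eq_zero _).2 fun ψ hψ => ?_
  rw [ContinuousLinearMap.coe_coe, evolution_apply] at hψ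
  rw [← norm_eq_zero, ← norm_fapply_exp (P := P) t ψ, hψ, norm_zero]

/-- The operator with spectral measure `P` acts on its domain as `ψ ↦ ∫ ω dE(ω) ψ`. -/
lemma apply_eq_fapply_of_isSpectralMeasureOf {A : E →ₗ.[ℂ] E} (hA : IsSpectralMeasureOf P A)
    (hd : Dense (A.domain : Set E)) (ψ : A.domain) :
    MemLp (fun ω : ℝ => (ω : ℂ)) 2 (P.measure (ψ : E)) ∧
      A ψ = P.fapply (fun ω : ℝ => (ω : ℂ)) (ψ : E) := by
  have hm : ∀ ψ : A.domain, MemLp (fun ω : ℝ => (ω : ℂ)) 2 (P.measure (ψ : E)) := fun ψ => by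
    refine memLp_two_iff_lintegral.2 ⟨by fun_prop, ?_⟩
    have := (hA.1 ψ).1 ψ.2
    simpa [← ofReal_norm] using this
  refine ⟨hm ψ, ?_⟩
  have hadd : ∀ ψ φ : A.domain, P.fapply (fun ω : ℝ => (ω : ℂ)) ((ψ + φ : A.domain) : E) =
      P.fapply (fun ω : ℝ => (ω : ℂ)) (ψ : E) + P.fapply (fun ω : ℝ => (ω : ℂ)) (φ : E) :=
    fun ψ φ => by
      simpa using fapply_smul_add (1 : ℂ) (hm ψ) (hm φ)
  have hz : P.fapply (fun ω : ℝ => (ω : ℂ)) (0 : E) = 0 := by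
    simpa using hadd 0 0
  have hsmul : ∀ (c : ℂ) (ψ : A.domain), P.fapply (fun ω : ℝ => (ω : ℂ)) ((c • ψ : A.domain) : E) =
      c • P.fapply (fun ω : ℝ => (ω : ℂ)) (ψ : E) := fun c ψ => by
    simpa [hz] using fapply_smul_add c (hm ψ) (hm 0)
  let T : A.domain →ₗ[ℂ] E := ⟨⟨fun ψ => P.fapply (fun ω : ℝ => (ω : ℂ)) (ψ : E), hadd⟩, hsmul⟩
  -- Only the diagonal elements of `A` are prescribed; polarization and density of the domain
  -- recover `A` itself.
  have hS := inner_eq_zero_of_forall_inner_self (A.toFun - T) fun ψ => by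
    have h1 : inner ℂ (ψ : E) (T ψ) = inner ℂ (ψ : E) (A ψ) := by
      rw [hA.2 ψ, ← integral_complex_ofReal]
      exact inner_fapply_self (hm ψ)
    rw [LinearMap.sub_apply, inner_sub_right, h1]
    exact sub_self _
  have h0 : (A.toFun - T) ψ = 0 :=
    hd.eq_zero_of_inner_right ℂ fun φ hφ => hS ⟨φ, hφ⟩ ψ
  exact sub_eq_zero.1 h0

end ProjMeasure

/-! ### The Fock basis and the Jacobi operator -/

lemma ket_apply (n k : ℕ) : ket n k = if k = n then 1 else 0 := by
  rw [ket, lp.single_apply, Pi.single_apply]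

lemma inner_ket (n : ℕ) (ψ : Fock) : inner ℂ (ket n) ψ = ψ n := by
  rw [ket, lp.inner_single_left]
  simp

lemma norm_ket (n : ℕ) : ‖ket n‖ = 1 := by
  rw [ket, lp.norm_single (by norm_num), norm_one]

lemma hasSum_ket (ψ : Fock) : HasSum (fun n => ψ n • ket n) ψ := by
  have := lp.hasSum_single (p := 2) (by norm_num) ψ
  refine this.congr_fun fun n => ?_
  rw [ket, ← lp.single_smul, smul_eq_mul, mul_one]

lemma ket_mem_finiteSpan (n : ℕ) : ket n ∈ finiteSpan := by
  refine (Set.finite_singleton n).subset fun k hk => ?_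
  by_contra h
  exact hk (by rw [ket_apply, if_neg (show ¬k = n from fun e => h e)])

lemma dense_finiteSpan : Dense (finiteSpan : Set Fock) := fun ψ =>
  mem_closure_of_tendsto (hasSum_ket ψ) (Eventually.of_forall fun _ =>
    Submodule.sum_mem _ fun _ _ => Submodule.smul_mem _ _ (ket_mem_finiteSpan _))

/-- `ψ` is a combination of `|0⟩, …, |n⟩` with positive leading coefficient. -/
def HasPosLeading (ψ : Fock) (n : ℕ) : Prop :=
  (∀ k, n < k → ψ k = 0) ∧ ∃ a : ℝ, 0 < a ∧ ψ n = a

lemma HasPosLeading.mem_finiteSpan {ψ : Fock} {n : ℕ} (h : HasPosLeading ψ n) :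
    ψ ∈ finiteSpan := by
  refine (Set.finite_Iic n).subset fun k hk => ?_
  by_contra hc
  exact hk (h.1 k (not_le.1 hc))

lemma jacobiKet_apply (h b : ℕ → ℝ) (n k : ℕ) : jacobiKet h b n k =
    h n * ket n k + b n * ket (n - 1) k + b (n + 1) * ket (n + 1) k := rfl

lemma jacobiKet_apply_of_lt (h b : ℕ → ℝ) {m k : ℕ} (hk : m + 1 < k) : jacobiKet h b m k = 0 := by
  have h1 : k ≠ m := by omega
  have h2 : k ≠ m - 1 := by omega
  have h3 : k ≠ m + 1 := by omega
  simp [jacobiKet_apply, ket_apply, h1, h2, h3]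

lemma jacobiKet_apply_succ (h b : ℕ → ℝ) (n : ℕ) : jacobiKet h b n (n + 1) = b (n + 1) := by
  have h2 : n + 1 ≠ n - 1 := by omega
  simp [jacobiKet_apply, ket_apply, h2]

/-- Among the images of `|0⟩, …, |n⟩` only that of `|n⟩` reaches `|n+1⟩`, with coefficient `b (n +
1) > 0`. -/
lemma HasPosLeading.apply_jacobiOp {h b : ℕ → ℝ} (hb : ∀ n, 1 ≤ n → 0 < b n) {ψ : Fock} {n : ℕ}
    (hψ : HasPosLeading ψ n) :
    HasPosLeading (jacobiOp h b ⟨ψ, hψ.mem_finiteSpan⟩) (n + 1) := by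
  have h1 : jacobiOp h b ⟨ψ, hψ.mem_finiteSpan⟩ =
      ∑ m ∈ Finset.range (n + 1), ψ m • jacobiKet h b m := by
    refine tsum_eq_sum fun m hm => ?_
    rw [Finset.mem_range, not_lt] at hm
    change ψ m • _ = 0
    rw [hψ.1 m hm, zero_smul]
  have h2 : ∀ k, jacobiOp h b ⟨ψ, hψ.mem_finiteSpan⟩ k =
      ∑ m ∈ Finset.range (n + 1), ψ m * jacobiKet h b m k := fun k => by
    rw [h1, lp.coeFn_sum, Finset.sum_apply]
    rfl
  refine ⟨fun k hk => ?_, ?_⟩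
  · rw [h2]
    refine Finset.sum_eq_zero fun m hm => ?_
    rw [Finset.mem_range] at hm
    rw [jacobiKet_apply_of_lt h b (by omega), mul_zero]
  · obtain ⟨a, ha, hn⟩ := hψ.2
    refine ⟨a * b (n + 1), mul_pos ha (hb _ (by omega)), ?_⟩
    rw [h2, Finset.sum_range_succ, Finset.sum_eq_zero fun m hm => ?_, hn, jacobiKet_apply_succ]
    · push_cast
      ring
    · rw [Finset.mem_range] at hm
      rw [jacobiKet_apply_of_lt h b (by omega), mul_zero]

/-! ### The Gram-Schmidt process and isometries -/

open InnerProductSpace in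
-- The earlier vectors are nonzero multiples of `|0⟩, …, |n-1⟩`, so the projections remove exactly
-- the coordinates below `n`.
lemma gramSchmidt_of_hasPosLeading {v : ℕ → Fock} (hv : ∀ n, HasPosLeading (v n) n) (n : ℕ) :
    gramSchmidt ℂ v n = v n n • ket n := by
  induction n using Nat.strong_induction_on with
  | _ n ih =>
    have h2 : ∀ i ∈ Finset.Iio n, (inner ℂ (gramSchmidt ℂ v i) (v n) /
        (‖gramSchmidt ℂ v i‖ : ℂ) ^ 2) • gramSchmidt ℂ v i = v n i • ket i := by
      intro i hi
      obtain ⟨a, ha, hai⟩ := (hv i).2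
      have ha' : (a : ℂ) ≠ 0 := by exact_mod_cast ha.ne'
      rw [ih i (Finset.mem_Iio.1 hi), hai, inner_smul_left, inner_ket, norm_smul, norm_ket,
        smul_smul, Complex.conj_ofReal, Complex.norm_real, Real.norm_of_nonneg ha.le]
      congr 1
      push_cast
      field_simp
    have h3 : v n = v n n • ket n + ∑ i ∈ Finset.Iio n, v n i • ket i := by
      refine (hasSum_ket (v n)).unique ?_
      have h4 : v n n • ket n + ∑ i ∈ Finset.Iio n, v n i • ket i =
          ∑ i ∈ Finset.Iic n, v n i • ket i := by
        rw [← Finset.Iio_insert, Finset.sum_insert (by simp)]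
      rw [h4]
      refine hasSum_sum_of_ne_finset_zero fun k hk => ?_
      rw [(hv n).1 k (by simpa using hk), zero_smul]
    have h1 : v n = gramSchmidt ℂ v n + ∑ i ∈ Finset.Iio n, v n i • ket i :=
      (gramSchmidt_def'' ℂ v n).trans (congrArg _ (Finset.sum_congr rfl h2))
    exact add_right_cancel (h1.symm.trans h3)

open InnerProductSpace in
-- Positivity of the leading coefficient fixes the phase.
lemma gramSchmidtNormed_of_hasPosLeading {v : ℕ → Fock} (hv : ∀ n, HasPosLeading (v n) n)
    (n : ℕ) : gramSchmidtNormed ℂ v n = ket n := by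
  obtain ⟨a, ha, hn⟩ := (hv n).2
  have ha' : (a : ℂ) ≠ 0 := by exact_mod_cast ha.ne'
  rw [gramSchmidtNormed, gramSchmidt_of_hasPosLeading hv, hn, norm_smul, norm_ket, mul_one,
    Complex.norm_real, Real.norm_of_nonneg ha.le, smul_smul]
  simp [ha']

open InnerProductSpace in
lemma map_gramSchmidt {E F : Type*} [NormedAddCommGroup E] [InnerProductSpace ℂ E]
    [NormedAddCommGroup F] [InnerProductSpace ℂ F] (V : E →ₗᵢ[ℂ] F) (f : ℕ → E) (n : ℕ) :
    V (gramSchmidt ℂ f n) = gramSchmidt ℂ (fun k => V (f k)) n := by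
  induction n using Nat.strong_induction_on with
  | _ n ih =>
    have h1 := congrArg V (gramSchmidt_def'' ℂ f n)
    have h2 := gramSchmidt_def'' ℂ (fun k => V (f k)) n
    rw [map_add, map_sum] at h1
    rw [Finset.sum_congr rfl fun i hi => ?_] at h2
    · exact add_right_cancel (h1.symm.trans h2)
    · rw [← ih i (Finset.mem_Iio.1 hi), V.inner_map_map, V.norm_map, map_smul]

open InnerProductSpace in
lemma map_gramSchmidtNormed {E F : Type*} [NormedAddCommGroup E] [InnerProductSpace ℂ E]
    [NormedAddCommGroup F] [InnerProductSpace ℂ F] (V : E →ₗᵢ[ℂ] F) (f : ℕ → E) (n : ℕ) :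
    V (gramSchmidtNormed ℂ f n) = gramSchmidtNormed ℂ (fun k => V (f k)) n := by
  rw [gramSchmidtNormed, gramSchmidtNormed, map_smul, map_gramSchmidt, ← map_gramSchmidt V f,
    V.norm_map]

/-! ### The map `U` -/

lemma memLp_pow_of_absMoment_lt_top {σ : Measure ℝ} (hfin : ∀ n, absMoment σ n < ∞) (n : ℕ) :
    MemLp (fun ω : ℝ => (ω : ℂ) ^ n) 2 σ := by
  refine ProjMeasure.memLp_two_iff_lintegral.2 ⟨by fun_prop, ?_⟩
  have h := hfin (n * 2)
  simpa [absMoment, pow_mul, ← ofReal_norm] using h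

/-! ### The vectors `Hⁿ|0⟩` and the orthonormal polynomials. -/

section Jacobi

variable {h b : ℕ → ℝ} {P : ProjMeasure Fock}

lemma hasPosLeading_fapply_pow (hb : ∀ n, 1 ≤ n → 0 < b n)
    (hP : IsSpectralMeasureOf P (jacobiOp h b).closure)
    (hfin : ∀ n, absMoment (P.measure (ket 0)) n < ∞) (n : ℕ) :
    HasPosLeading (P.fapply (fun ω => (ω : ℂ) ^ n) (ket 0)) n := by
  have hd : Dense ((jacobiOp h b).closure.domain : Set Fock) :=
    dense_finiteSpan.mono (jacobiOp h b).le_closure.1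
  induction n with
  | zero =>
    simp only [pow_zero]
    rw [ProjMeasure.fapply_one]
    exact ⟨fun k hk => by rw [ket_apply, if_neg hk.ne'], 1, one_pos, by simp [ket_apply]⟩
  | succ n ih =>
    have hm := memLp_pow_of_absMoment_lt_top hfin n
    set ψ := P.fapply (fun ω => (ω : ℂ) ^ n) (ket 0) with hψ
    have h1 := ih.apply_jacobiOp (h := h) hb
    -- `Hⁿ|0⟩` stays in the finite span, where the closure still acts by the three-diagonal formula.
    have h2 : jacobiOp h b ⟨ψ, ih.mem_finiteSpan⟩ =
        (jacobiOp h b).closure ⟨ψ, (jacobiOp h b).le_closure.1 ih.mem_finiteSpan⟩ :=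
      (jacobiOp h b).le_closure.2 rfl
    have h3 := ProjMeasure.apply_eq_fapply_of_isSpectralMeasureOf hP hd
      ⟨ψ, (jacobiOp h b).le_closure.1 ih.mem_finiteSpan⟩
    have h4 := ProjMeasure.fapply_fapply (by fun_prop) hm h3.1
    rw [h2, h3.2, h4] at h1
    convert h1 using 2
    ext ω
    simp [pow_succ, mul_comm]

lemma cyclic_orthoPoly (hb : ∀ n, 1 ≤ n → 0 < b n)
    (hP : IsSpectralMeasureOf P (jacobiOp h b).closure)
    (hfin : ∀ n, absMoment (P.measure (ket 0)) n < ∞) (n : ℕ) :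
    P.cyclic (ket 0) (orthoPoly (P.measure (ket 0)) n) = ket n := by
  rw [orthoPoly, map_gramSchmidtNormed]
  refine gramSchmidtNormed_of_hasPosLeading (fun n => ?_) n
  have := hasPosLeading_fapply_pow hb hP hfin n
  rw [ProjMeasure.fapply_of_memLp (memLp_pow_of_absMoment_lt_top hfin n)] at this
  rwa [monomialL2, dif_pos (memLp_pow_of_absMoment_lt_top hfin n)]

end Jacobi

/-! ### The map `U` as a left inverse of the cyclic isometry. -/

section Cyclic

variable {P : ProjMeasure Fock}

lemma toL2_cyclic (hU : ∀ n, P.cyclic (ket 0) (orthoPoly (P.measure (ket 0)) n) = ket n)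
    (f : Lp ℂ 2 (P.measure (ket 0))) :
    toL2 (P.measure (ket 0)) (P.cyclic (ket 0) f) = f := by
  refine HasSum.tsum_eq ?_
  refine ((P.cyclic (ket 0)).isometry.isEmbedding.isInducing.hasSum_iff
    _ _).1 ?_
  have := hasSum_ket (P.cyclic (ket 0) f)
  refine this.congr_fun fun n => ?_
  change P.cyclic (ket 0) _ = _
  rw [map_smul, hU]

lemma coherent_eq_cyclic
    (hU : ∀ n, P.cyclic (ket 0) (orthoPoly (P.measure (ket 0)) n) = ket n) (z : ℂ) :
    coherent (P.measure (ket 0)) z = P.cyclic (ket 0) (expL2 (P.measure (ket 0)) z) := by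
  have h1 : ∀ n, coherentCoeff (P.measure (ket 0)) n z =
      P.cyclic (ket 0) (expL2 (P.measure (ket 0)) z) n := fun n => by
    rw [← inner_ket, ← hU n, LinearIsometry.inner_map_map, coherentCoeff]
  rw [coherent]
  simp only [h1]
  exact (hasSum_ket _).tsum_eq

end Cyclic

open ProbabilityTheory

/-! ### Exponential integrability -/

/-- Even-degree terms are nonnegative, so by Tonelli they sum to `∫ cosh(δω) e^{yω} dσ`, and `e^{δω}
≤ 2 cosh(δω)`. -/
lemma mem_integrableExpSet_of_summable {σ : Measure ℝ} {y δ : ℝ}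
    (hi : ∀ k : ℕ, Integrable (fun ω => ω ^ (2 * k) * Real.exp (y * ω)) σ)
    (hs : Summable fun k : ℕ =>
      δ ^ (2 * k) / (2 * k).factorial * ∫ ω, ω ^ (2 * k) * Real.exp (y * ω) ∂σ) :
    y + δ ∈ integrableExpSet id σ := by
  have h0 : ∀ (k : ℕ) (x : ℝ), 0 ≤ x ^ (2 * k) := fun k x => by
    rw [pow_mul]; positivity
  have h1 : ∀ ω : ℝ, HasSum (fun k : ℕ => δ ^ (2 * k) / (2 * k).factorial *
      (ω ^ (2 * k) * Real.exp (y * ω))) (Real.cosh (δ * ω) * Real.exp (y * ω)) := fun ω => by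
    refine ((Real.hasSum_cosh (δ * ω)).mul_right (Real.exp (y * ω))).congr_fun fun k => ?_
    rw [mul_pow]
    ring
  have hc : ∀ k : ℕ, 0 ≤ δ ^ (2 * k) / (2 * k).factorial := fun k =>
    div_nonneg (h0 k δ) (by positivity)
  have hnn : ∀ (k : ℕ) (ω : ℝ), 0 ≤ δ ^ (2 * k) / (2 * k).factorial *
      (ω ^ (2 * k) * Real.exp (y * ω)) := fun k ω =>
    mul_nonneg (hc k) (mul_nonneg (h0 k ω) (Real.exp_pos _).le)
  have h2 : Integrable (fun ω => Real.cosh (δ * ω) * Real.exp (y * ω)) σ := by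
    refine ⟨by fun_prop, ?_⟩
    rw [hasFiniteIntegral_iff_ofReal (Eventually.of_forall fun ω => by positivity)]
    have h3 : ∀ ω, ENNReal.ofReal (Real.cosh (δ * ω) * Real.exp (y * ω)) =
        ∑' k : ℕ, ENNReal.ofReal (δ ^ (2 * k) / (2 * k).factorial *
          (ω ^ (2 * k) * Real.exp (y * ω))) := fun ω => by
      rw [← ENNReal.ofReal_tsum_of_nonneg (fun k => hnn k ω) (h1 ω).summable, (h1 ω).tsum_eq]
    simp only [h3]
    rw [lintegral_tsum fun k => by fun_prop]
    have h4 : ∀ k : ℕ, ∫⁻ ω, ENNReal.ofReal (δ ^ (2 * k) / (2 * k).factorial *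
        (ω ^ (2 * k) * Real.exp (y * ω))) ∂σ = ENNReal.ofReal (δ ^ (2 * k) / (2 * k).factorial *
          ∫ ω, ω ^ (2 * k) * Real.exp (y * ω) ∂σ) := fun k => by
      rw [← integral_const_mul, ofReal_integral_eq_lintegral_ofReal ((hi k).const_mul _)
        (Eventually.of_forall fun ω => hnn k ω)]
    simp only [h4]
    rw [← ENNReal.ofReal_tsum_of_nonneg (fun k => ?_) hs]
    · exact ENNReal.ofReal_lt_top
    · exact mul_nonneg (hc k) (integral_nonneg fun ω => mul_nonneg (h0 k ω) (Real.exp_pos _).le)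
  refine Integrable.mono' (h2.const_mul 2) (by fun_prop) (Eventually.of_forall fun ω => ?_)
  rw [Real.norm_of_nonneg (Real.exp_pos _).le, id, add_mul, Real.exp_add, Real.cosh_eq]
  have := mul_pos (Real.exp_pos (-(δ * ω))) (Real.exp_pos (y * ω))
  nlinarith

lemma mem_interior_integrableExpSet_of_ball {σ : Measure ℝ} {y ρ : ℝ} {x : ℝ}
    (hx : |x - y| < ρ) (h : ∀ δ, |δ| < ρ → y + δ ∈ integrableExpSet id σ) :
    x ∈ interior (integrableExpSet id σ) := by
  refine mem_interior.2 ⟨Metric.ball y ρ, fun t ht => ?_, Metric.isOpen_ball, hx⟩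
  have := h (t - y) ht
  rwa [add_sub_cancel] at this

lemma zero_mem_interior_integrableExpSet {σ : Measure ℝ} (hfin : ∀ n, absMoment σ n < ∞)
    (hlim : limsup (fun n : ℕ => absMoment σ n ^ (1 / (n : ℝ)) / (n : ℝ≥0∞)) atTop < ∞) :
    0 ∈ interior (integrableExpSet id σ) := by
  obtain ⟨C, hC, -⟩ := ENNReal.lt_iff_exists_nnreal_btwn.1 hlim
  have h1 : ∀ᶠ n : ℕ in atTop, absMoment σ n ≤ ENNReal.ofReal ((C * n) ^ n) := by
    filter_upwards [eventually_lt_of_limsup_lt hC, eventually_ge_atTop 1] with n hn hn1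
    have hn0 : (n : ℝ) ≠ 0 := by positivity
    have h2 : absMoment σ n ^ (1 / (n : ℝ)) ≤ C * n :=
      (ENNReal.div_le_iff (by exact_mod_cast (by omega : n ≠ 0)) (by simp)).1 hn.le
    have h3 : absMoment σ n = (absMoment σ n ^ (1 / (n : ℝ))) ^ n := by
      rw [← ENNReal.rpow_natCast, ← ENNReal.rpow_mul, one_div_mul_cancel hn0, ENNReal.rpow_one]
    rw [h3, ENNReal.ofReal_pow (by positivity), ENNReal.ofReal_mul (by positivity)]
    simpa using pow_le_pow_left' h2 n
  have hpow : ∀ k : ℕ, ∫⁻ ω, ENNReal.ofReal (ω ^ (2 * k)) ∂σ = absMoment σ (2 * k) := fun k => by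
    refine lintegral_congr fun ω => ?_
    rw [← ofReal_norm, ← ENNReal.ofReal_pow (norm_nonneg _), ← norm_pow, Real.norm_of_nonneg]
    rw [pow_mul]; positivity
  have h0 : ∀ (k : ℕ) (x : ℝ), 0 ≤ x ^ (2 * k) := fun k x => by
    rw [pow_mul]; positivity
  have hi : ∀ k : ℕ, Integrable (fun ω : ℝ => ω ^ (2 * k)) σ := fun k => by
    refine ⟨by fun_prop, ?_⟩
    rw [hasFiniteIntegral_iff_ofReal (Eventually.of_forall (h0 k)), hpow]
    exact hfin _
  -- With `|μ|_n ≤ (Cn)^n` and `n^n/n! ≤ e^n`, the terms are at most `(|δ|Ce)^n`; this radius makes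
  -- the base at most `1/2`. Using `C + 1` covers `C = 0`.
  set r : ℝ := 1 / (2 * (C + 1) * Real.exp 1) with hr
  have hr0 : 0 < r := by positivity
  refine mem_interior_integrableExpSet_of_ball (y := 0) (ρ := r) (by simpa) fun δ hδ => ?_
  refine mem_integrableExpSet_of_summable (by simpa using hi) ?_
  simp only [zero_mul, Real.exp_zero, mul_one]
  have hg : Summable fun k : ℕ => (1 / 2 : ℝ) ^ (2 * k) := by
    simp only [pow_mul]
    exact summable_geometric_of_lt_one (by norm_num) (by norm_num)
  refine hg.of_norm_bounded_eventually_nat ?_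
  have h2k : Tendsto (fun k : ℕ => 2 * k) atTop atTop :=
    tendsto_id.const_mul_atTop' (by norm_num)
  filter_upwards [h2k.eventually h1] with k hk
  rw [Real.norm_of_nonneg (mul_nonneg (div_nonneg (h0 k δ) (by positivity))
    (integral_nonneg fun ω => h0 k ω))]
  have hm : ∫ ω, ω ^ (2 * k) ∂σ ≤ (C * (2 * k : ℕ)) ^ (2 * k) := by
    rw [integral_eq_lintegral_of_nonneg_ae (Eventually.of_forall (h0 k)) (by fun_prop), hpow]
    exact ENNReal.toReal_le_of_le_ofReal (h0 _ _) hk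
  have hab : δ ^ (2 * k) = |δ| ^ (2 * k) := by rw [pow_mul, pow_mul, sq_abs]
  rw [hab]
  generalize 2 * k = n at hm
  have he := Real.pow_div_factorial_le_exp (n : ℝ) (by positivity) n
  rw [show Real.exp (n : ℝ) = Real.exp 1 ^ n by rw [← Real.exp_nat_mul, mul_one]] at he
  have hsmall : |δ| * C * Real.exp 1 ≤ 1 / 2 := by
    have h5 : |δ| * C * Real.exp 1 ≤ r * (C + 1) * Real.exp 1 := by gcongr; linarith
    refine h5.trans_eq ?_
    rw [hr]
    field_simp
  calc |δ| ^ n / n.factorial * ∫ ω, ω ^ n ∂σ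
      ≤ |δ| ^ n / n.factorial * (C * n) ^ n := by gcongr
    _ = (|δ| * C) ^ n * ((n : ℝ) ^ n / n.factorial) := by rw [mul_pow, mul_pow]; ring
    _ ≤ (|δ| * C) ^ n * Real.exp 1 ^ n := by gcongr
    _ = (|δ| * C * Real.exp 1) ^ n := (mul_pow _ _ _).symm
    _ ≤ (1 / 2) ^ n := by gcongr

/-! ### The maximal strip -/

lemma differentiableOn_complexMGF_neg_I_mul (σ : Measure ℝ) :
    DifferentiableOn ℂ (fun z => complexMGF id σ (-Complex.I * z))
      {z | z.im ∈ interior (integrableExpSet id σ)} := by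
  refine differentiableOn_complexMGF.comp (by fun_prop) fun z hz => ?_
  simpa using hz

lemma isOpen_im_preimage {J : Set ℝ} (hJ : IsOpen J) : IsOpen {z : ℂ | z.im ∈ J} :=
  hJ.preimage Complex.continuous_im

lemma convex_im_preimage {J : Set ℝ} (hJ : Convex ℝ J) : Convex ℝ {z : ℂ | z.im ∈ J} :=
  hJ.linear_preimage Complex.imLm

/-- Identity theorem: the two functions agree on the real axis, which accumulates at `0`. -/
lemma eqOn_complexMGF_of_isHolExtension {σ : Measure ℝ} {J : Set ℝ} (hJ : IsOpen J)
    (hJc : Convex ℝ J) (h0 : 0 ∈ J) {f : ℂ → ℂ} (hf : IsHolExtension σ {z | z.im ∈ J} f)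
    (hI : J ⊆ interior (integrableExpSet id σ)) :
    Set.EqOn f (fun z => complexMGF id σ (-Complex.I * z)) {z | z.im ∈ J} := by
  have ho := isOpen_im_preimage hJ
  refine AnalyticOnNhd.eqOn_of_preconnected_of_frequently_eq (hf.1.analyticOnNhd ho)
    (((differentiableOn_complexMGF_neg_I_mul σ).mono fun z hz => hI hz).analyticOnNhd ho)
    (convex_im_preimage hJc).isPreconnected (z₀ := 0) (by simpa using h0) ?_
  have ht : Tendsto (fun t : ℝ => (t : ℂ)) (𝓝[≠] 0) (𝓝[≠] 0) := by
    refine tendsto_nhdsWithin_iff.2 ⟨?_, ?_⟩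
    · exact (Complex.continuous_ofReal.tendsto' 0 0 (by simp)).mono_left nhdsWithin_le_nhds
    · filter_upwards [self_mem_nhdsWithin] with t ht
      simpa using ht
  exact ht.frequently (Eventually.of_forall fun t => hf.2 t).frequently

/-- A holomorphic extension of the characteristic function to a strip forces exponential
integrability on the strip. -/
lemma subset_interior_integrableExpSet {σ : Measure ℝ} {J : Set ℝ} (hJ : IsOpen J)
    (hJc : Convex ℝ J) (h0 : 0 ∈ J) {f : ℂ → ℂ} (hf : IsHolExtension σ {z | z.im ∈ J} f)
    (h0I : 0 ∈ interior (integrableExpSet id σ)) :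
    J ⊆ interior (integrableExpSet id σ) := by
  set I := interior (integrableExpSet id σ) with hI
  suffices h : J ⊆ I ∩ J from fun y hy => (h hy).1
  have hIo : IsOpen (I ∩ J) := isOpen_interior.inter hJ
  have hIc : Convex ℝ (I ∩ J) := convex_integrableExpSet.interior.inter hJc
  have heq := eqOn_complexMGF_of_isHolExtension hIo hIc ⟨h0I, h0⟩
    ⟨hf.1.mono fun z hz => hz.2, hf.2⟩ Set.inter_subset_left
  -- As `J` is connected, it suffices that `I ∩ J` is relatively closed in `J`.
  refine hJc.isPreconnected.subset_of_closure_inter_subset hIo ⟨0, h0, h0I, h0⟩ ?_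
  rintro y ⟨hyc, hyJ⟩
  refine ⟨?_, hyJ⟩
  obtain ⟨ε, hε, hball⟩ := Metric.isOpen_iff.1 hJ y hyJ
  obtain ⟨y₀, hy₀, hd⟩ := Metric.mem_closure_iff.1 hyc (ε / 2) (half_pos hε)
  rw [Real.dist_eq] at hd
  refine mem_interior_integrableExpSet_of_ball (y := y₀) (ρ := ε / 2) hd fun δ hδ => ?_
  -- After rotation the extension continues the Laplace transform of `σ`. The disc of radius `ε/2`
  -- about `y₀` contains `y`, and its points have real part in `J`.
  have hF : DifferentiableOn ℂ (fun w => f (Complex.I * w)) (Metric.ball (y₀ : ℂ) (ε / 2)) := by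
    refine hf.1.comp (by fun_prop) fun w hw => ?_
    have h1 : |w.re - y₀| < ε / 2 := by
      have h2 := Complex.abs_re_le_norm (w - y₀)
      rw [Complex.sub_re, Complex.ofReal_re] at h2
      exact h2.trans_lt (by simpa [dist_eq_norm] using hw)
    simp only [Set.mem_ofPred_eq, Complex.mul_im, Complex.I_re, Complex.I_im, zero_mul, one_mul,
      zero_add]
    refine hball ?_
    rw [Metric.mem_ball, Real.dist_eq]
    rw [abs_lt] at *
    constructor <;> linarith
  have hev : (fun w => f (Complex.I * w)) =ᶠ[𝓝 (y₀ : ℂ)] complexMGF id σ := by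
    have ho : {w : ℂ | w.re ∈ I ∩ J} ∈ 𝓝 (y₀ : ℂ) :=
      (hIo.preimage Complex.continuous_re).mem_nhds (by simpa using hy₀)
    filter_upwards [ho] with w hw
    have := heq (x := Complex.I * w) (by simpa using hw)
    simp only at this
    rw [this, ← mul_assoc, neg_mul, Complex.I_mul_I, neg_neg, one_mul]
  have hder : ∀ n, iteratedDeriv n (fun w => f (Complex.I * w)) (y₀ : ℂ) =
      ((∫ ω, ω ^ n * Real.exp (y₀ * ω) ∂σ : ℝ) : ℂ) := fun n => by
    rw [hev.iteratedDeriv_eq, iteratedDeriv_complexMGF (by simpa using hy₀.1),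
      ← integral_complex_ofReal]
    simp
  have hsum := Complex.hasSum_taylorSeries_on_ball (c := (y₀ : ℂ)) (r := ε / 2)
    (z := (y₀ : ℂ) + δ) hF (by simpa using hδ)
  refine mem_integrableExpSet_of_summable (fun k =>
    integrable_pow_mul_exp_of_mem_interior_integrableExpSet hy₀.1 (2 * k)) ?_
  -- The Taylor coefficients at `y₀` are moments of `e^{y₀ω} dσ`. Summability is unconditional, so
  -- the even terms may be kept alone.
  have h2 := hsum.summable.comp_injective (mul_right_injective₀ (two_ne_zero (α := ℕ)))
  refine (Complex.hasSum_re h2.hasSum).summable.congr fun k => ?_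
  simp only [Function.comp, hder, add_sub_cancel_left]
  rw [smul_eq_mul, smul_eq_mul, ← Complex.ofReal_natCast, ← Complex.ofReal_inv,
    ← Complex.ofReal_pow, ← Complex.ofReal_mul, ← Complex.ofReal_mul, Complex.ofReal_re]
  ring

lemma isHolStrip_im_preimage {σ : Measure ℝ} (h0I : 0 ∈ interior (integrableExpSet id σ)) :
    IsHolStrip σ {z | z.im ∈ interior (integrableExpSet id σ)} := by
  refine ⟨isOpen_im_preimage isOpen_interior, ⟨⟨0, by simpa using h0I⟩,
    (convex_im_preimage convex_integrableExpSet.interior).isPreconnected⟩, fun t => by simpa using h0I,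
    fun z hz t => by simpa using hz, _, differentiableOn_complexMGF_neg_I_mul σ, fun t => rfl⟩

/-- Translation invariance makes `S` the full preimage of `Im S`, an open interval. -/
lemma IsHolStrip.subset {σ : Measure ℝ} (h0I : 0 ∈ interior (integrableExpSet id σ)) {S : Set ℂ}
    (hS : IsHolStrip σ S) : S ⊆ {z | z.im ∈ interior (integrableExpSet id σ)} := by
  obtain ⟨ho, hc, hr, ht, f, hf⟩ := hS
  have hSJ : S = {z : ℂ | z.im ∈ Complex.im '' S} := by
    refine Set.Subset.antisymm (fun z hz => ⟨z, hz, rfl⟩) ?_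
    rintro z ⟨w, hw, hwz⟩
    have := ht w hw (z.re - w.re)
    convert this using 1
    apply Complex.ext <;> simp [hwz]
  have hJo : IsOpen (Complex.im '' S) := Complex.isOpenMap_im S ho
  have hJc : Convex ℝ (Complex.im '' S) :=
    (hc.isPreconnected.image _ Complex.continuous_im.continuousOn).convex
  rw [hSJ] at hf
  intro z hz
  exact subset_interior_integrableExpSet hJo hJc ⟨0, by simpa using hr 0, rfl⟩ hf h0I ⟨z, hz, rfl⟩

lemma maxStrip_eq {σ : Measure ℝ} (h0I : 0 ∈ interior (integrableExpSet id σ)) :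
    maxStrip σ = {z | z.im ∈ interior (integrableExpSet id σ)} :=
  Set.Subset.antisymm (Set.sUnion_subset fun _ hS => IsHolStrip.subset h0I hS)
    (Set.subset_sUnion_of_mem (isHolStrip_im_preimage h0I))

lemma mem_halfStrip_iff {σ : Measure ℝ} (h0I : 0 ∈ interior (integrableExpSet id σ)) {z : ℂ} :
    z ∈ halfStrip σ ↔ 2 * z.im ∈ interior (integrableExpSet id σ) := by
  rw [halfStrip, maxStrip_eq h0I]
  simp

lemma isOpen_halfStrip {σ : Measure ℝ} (h0I : 0 ∈ interior (integrableExpSet id σ)) :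
    IsOpen (halfStrip σ) := by
  have : halfStrip σ = (fun z : ℂ => 2 * z.im) ⁻¹' interior (integrableExpSet id σ) := by
    ext z
    exact mem_halfStrip_iff h0I
  rw [this]
  exact isOpen_interior.preimage (by fun_prop)

/-- Uniqueness of the extension makes the choice in `charExt` immaterial on the strip. -/
lemma charExt_eq {σ : Measure ℝ} (h0I : 0 ∈ interior (integrableExpSet id σ)) {z : ℂ}
    (hz : z.im ∈ interior (integrableExpSet id σ)) :
    charExt σ z = complexMGF id σ (-Complex.I * z) := by
  have hex : ∃ f, IsHolExtension σ (maxStrip σ) f := by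
    rw [maxStrip_eq h0I]
    exact (isHolStrip_im_preimage h0I).2.2.2.2
  have hs := hex.choose_spec
  rw [charExt, dif_pos hex]
  generalize hex.choose = f at hs
  rw [maxStrip_eq h0I] at hs
  exact eqOn_complexMGF_of_isHolExtension isOpen_interior convex_integrableExpSet.interior h0I hs
    subset_rfl hz

lemma charExt_sub_conj {σ : Measure ℝ} (h0I : 0 ∈ interior (integrableExpSet id σ)) {z : ℂ}
    (hz : 2 * z.im ∈ interior (integrableExpSet id σ)) :
    charExt σ (z - conj z) = (mgf id σ (2 * z.im) : ℂ) := by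
  have h1 : z - conj z = ((2 * z.im : ℝ) : ℂ) * Complex.I := Complex.sub_conj z
  rw [charExt_eq h0I (by rw [h1]; simpa using hz), ← complexMGF_ofReal, h1]
  congr 1
  linear_combination -((2 * z.im : ℝ) : ℂ) * Complex.I_mul_I

/-! ### The exponentials in `L²` -/

section Exponentials

variable {σ : Measure ℝ} {z : ℂ}

lemma norm_exp_neg_I_mul (z : ℂ) (ω : ℝ) :
    ‖Complex.exp (-Complex.I * z * ω)‖ = Real.exp (z.im * ω) := by
  rw [Complex.norm_exp]
  simp

lemma conj_exp_mul_exp (z : ℂ) (ω : ℝ) :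
    conj (Complex.exp (-Complex.I * z * ω)) * Complex.exp (-Complex.I * z * ω) =
      (Real.exp (2 * z.im * ω) : ℂ) := by
  rw [← Complex.normSq_eq_conj_mul_self, Complex.normSq_eq_norm_sq, norm_exp_neg_I_mul,
    ← Real.exp_nat_mul]
  push_cast
  ring_nf

lemma memLp_pow_mul_exp (hz : 2 * z.im ∈ interior (integrableExpSet id σ)) (n : ℕ) :
    MemLp (fun ω : ℝ => (ω : ℂ) ^ n * Complex.exp (-Complex.I * z * ω)) 2 σ := by
  rw [memLp_two_iff_integrable_sq_norm (by fun_prop)]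
  refine (integrable_pow_mul_exp_of_mem_interior_integrableExpSet hz (n * 2)).congr
    (Eventually.of_forall fun ω => ?_)
  simp only [norm_mul, norm_exp_neg_I_mul, mul_pow, norm_pow, Complex.norm_real, id,
    ← Real.exp_nat_mul]
  rw [← pow_mul, pow_mul', pow_mul', Real.norm_eq_abs, sq_abs]
  push_cast
  ring_nf

lemma memLp_exp (hz : 2 * z.im ∈ interior (integrableExpSet id σ)) :
    MemLp (fun ω : ℝ => Complex.exp (-Complex.I * z * ω)) 2 σ := by
  simpa using memLp_pow_mul_exp hz 0

lemma expL2_eq (hz : 2 * z.im ∈ interior (integrableExpSet id σ)) :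
    expL2 σ z = (memLp_exp hz).toLp := dif_pos _

/-- The derivative `-iω e^{-izω}` of the exponential. -/
def expL2Deriv (σ : Measure ℝ) (z : ℂ)
    (hz : 2 * z.im ∈ interior (integrableExpSet id σ)) : Lp ℂ 2 σ :=
  (-Complex.I) • (memLp_pow_mul_exp hz 1).toLp

lemma inner_toLp_toLp {f g : ℝ → ℂ} (hf : MemLp f 2 σ) (hg : MemLp g 2 σ) :
    inner ℂ hf.toLp hg.toLp = ∫ ω, conj (f ω) * g ω ∂σ := by
  rw [L2.inner_def]
  refine integral_congr_ae ?_
  filter_upwards [hf.coeFn_toLp, hg.coeFn_toLp] with ω h1 h2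
  rw [h1, h2, RCLike.inner_apply']

lemma inner_pow_mul_exp (hz : 2 * z.im ∈ interior (integrableExpSet id σ)) (m n : ℕ) :
    inner ℂ (memLp_pow_mul_exp hz m).toLp (memLp_pow_mul_exp hz n).toLp =
      ((∫ ω, ω ^ (m + n) * Real.exp (2 * z.im * ω) ∂σ : ℝ) : ℂ) := by
  rw [inner_toLp_toLp, ← integral_complex_ofReal]
  refine integral_congr_ae (Eventually.of_forall fun ω => ?_)
  simp only [map_mul, map_pow, Complex.conj_ofReal, Complex.ofReal_mul, Complex.ofReal_pow,
    ← conj_exp_mul_exp]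
  ring

lemma expL2_eq_pow_zero (hz : 2 * z.im ∈ interior (integrableExpSet id σ)) :
    expL2 σ z = (memLp_pow_mul_exp hz 0).toLp := by
  rw [expL2_eq hz]
  congr 1
  simp

lemma inner_expL2_self (hz : 2 * z.im ∈ interior (integrableExpSet id σ)) :
    inner ℂ (expL2 σ z) (expL2 σ z) = (mgf id σ (2 * z.im) : ℂ) := by
  rw [expL2_eq_pow_zero hz, inner_pow_mul_exp hz]
  simp [mgf]

lemma inner_expL2_deriv (hz : 2 * z.im ∈ interior (integrableExpSet id σ)) :
    inner ℂ (expL2 σ z) (expL2Deriv σ z hz) =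
      -Complex.I * (∫ ω, ω * Real.exp (2 * z.im * ω) ∂σ : ℝ) := by
  rw [expL2_eq_pow_zero hz, expL2Deriv, inner_smul_right, inner_pow_mul_exp hz]
  simp

lemma inner_deriv_expL2 (hz : 2 * z.im ∈ interior (integrableExpSet id σ)) :
    inner ℂ (expL2Deriv σ z hz) (expL2 σ z) =
      Complex.I * (∫ ω, ω * Real.exp (2 * z.im * ω) ∂σ : ℝ) := by
  rw [expL2_eq_pow_zero hz, expL2Deriv, inner_smul_left, inner_pow_mul_exp hz]
  simp

lemma inner_deriv_deriv (hz : 2 * z.im ∈ interior (integrableExpSet id σ)) :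
    inner ℂ (expL2Deriv σ z hz) (expL2Deriv σ z hz) =
      (∫ ω, ω ^ 2 * Real.exp (2 * z.im * ω) ∂σ : ℝ) := by
  rw [expL2Deriv, inner_smul_left, inner_smul_right, inner_pow_mul_exp hz, ← mul_assoc]
  simp

/-- Second-order Taylor bound `|e^x - 1 - x| ≤ |x|² e^{|x|}` at `x = -ihω`. -/
lemma norm_exp_add_sub_sub_le (z h : ℂ) (ω : ℝ) :
    ‖Complex.exp (-Complex.I * (z + h) * ω) - Complex.exp (-Complex.I * z * ω) -
      h * (-Complex.I * (ω * Complex.exp (-Complex.I * z * ω)))‖ ≤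
      ‖h‖ ^ 2 * (|ω| ^ 2 * Real.exp (‖h‖ * |ω|) * Real.exp (z.im * ω)) := by
  have h1 : Complex.exp (-Complex.I * (z + h) * ω) - Complex.exp (-Complex.I * z * ω) -
      h * (-Complex.I * (ω * Complex.exp (-Complex.I * z * ω))) =
      (Complex.exp (-Complex.I * h * ω) - 1 - (-Complex.I * h * ω)) *
        Complex.exp (-Complex.I * z * ω) := by
    rw [show -Complex.I * (z + h) * ω = -Complex.I * h * ω + -Complex.I * z * ω by ring,
      Complex.exp_add]
    ring
  have h2 := Complex.norm_exp_sub_sum_le_norm_mul_exp (-Complex.I * h * ω) 2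
  have h3 : ‖-Complex.I * h * ω‖ = ‖h‖ * |ω| := by simp
  rw [h3] at h2
  simp only [Finset.sum_range_succ, Finset.sum_range_zero, zero_add, pow_zero, Nat.factorial_zero,
    Nat.factorial_one, Nat.cast_one, div_one, pow_one] at h2
  rw [h1, norm_mul, norm_exp_neg_I_mul, sub_sub]
  refine (mul_le_mul_of_nonneg_right h2 (Real.exp_pos _).le).trans_eq ?_
  ring

lemma hasDerivAt_expL2 (hz : 2 * z.im ∈ interior (integrableExpSet id σ)) :
    HasDerivAt (expL2 σ) (expL2Deriv σ z hz) z := by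
  obtain ⟨ε, hε, hball⟩ := Metric.isOpen_iff.1 isOpen_interior _ hz
  set ρ := ε / 4 with hρ
  have hρ0 : 0 < ρ := by positivity
  have hmem : ∀ t : ℝ, |t| < ε → 2 * z.im + t ∈ interior (integrableExpSet id σ) := fun t ht =>
    hball (by simpa [Real.dist_eq] using ht)
  -- This dominates the Taylor remainder divided by `|h|²` for `|h| < ρ`. Its square carries the
  -- weight `e^{2ρ|ω|}`, controlled by integrability at `2 Im z ± 3ρ`, where `3ρ < ε`.
  have hg : MemLp (fun ω : ℝ => |ω| ^ 2 * Real.exp (ρ * |ω|) * Real.exp (z.im * ω)) 2 σ := by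
    rw [memLp_two_iff_integrable_sq_norm (by fun_prop)]
    have h1 := hmem (3 * ρ) (by rw [abs_of_pos (by positivity)]; linarith)
    have h2 := hmem (-(3 * ρ)) (by rw [abs_neg, abs_of_pos (by positivity)]; linarith)
    have h3 := integrable_pow_abs_mul_exp_add_of_integrable_exp_mul (x := 2 * ρ)
      (interior_subset (s := integrableExpSet id σ) h1)
      (interior_subset (s := integrableExpSet id σ) h2) (by positivity)
      (by rw [abs_of_pos (by positivity)]; linarith) 4
    refine h3.congr (Eventually.of_forall fun ω => ?_)
    simp only [norm_mul, Real.norm_eq_abs, Real.abs_exp, abs_pow, abs_abs, id, mul_pow,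
      ← Real.exp_nat_mul]
    rw [mul_assoc ((|ω| ^ 2) ^ 2), ← Real.exp_add]
    push_cast
    ring_nf
  rw [hasDerivAt_iff_isLittleO_nhds_zero]
  have hO : (fun h => expL2 σ (z + h) - expL2 σ z - h • expL2Deriv σ z hz) =O[𝓝 0]
      fun h : ℂ => h ^ 2 := by
    refine Asymptotics.IsBigO.of_bound ‖hg.toLp‖ ?_
    filter_upwards [Metric.ball_mem_nhds (0 : ℂ) hρ0] with h hh
    have hh' : ‖h‖ < ρ := by simpa using hh
    have hzh : 2 * (z + h).im ∈ interior (integrableExpSet id σ) := by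
      rw [Complex.add_im, mul_add]
      refine hmem _ ?_
      rw [abs_mul, abs_two]
      have := Complex.abs_im_le_norm h
      linarith
    rw [norm_pow, mul_comm]
    refine Lp.norm_le_mul_norm_of_ae_le_mul ?_
    rw [expL2_eq hz, expL2_eq hzh, expL2Deriv]
    filter_upwards [hg.coeFn_toLp, (memLp_exp hz).coeFn_toLp, (memLp_exp hzh).coeFn_toLp,
      (memLp_pow_mul_exp hz 1).coeFn_toLp,
      Lp.coeFn_sub ((memLp_exp hzh).toLp - (memLp_exp hz).toLp)
        (h • (-Complex.I) • (memLp_pow_mul_exp hz 1).toLp),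
      Lp.coeFn_sub (memLp_exp hzh).toLp (memLp_exp hz).toLp,
      Lp.coeFn_smul h ((-Complex.I) • (memLp_pow_mul_exp hz 1).toLp),
      Lp.coeFn_smul (-Complex.I) (memLp_pow_mul_exp hz 1).toLp] with ω e1 e2 e3 e4 e5 e6 e7 e8
    rw [e5, Pi.sub_apply, e6, Pi.sub_apply, e7, Pi.smul_apply, e8, Pi.smul_apply, e1, e2, e3, e4,
      smul_eq_mul, smul_eq_mul, pow_one]
    refine (norm_exp_add_sub_sub_le z h ω).trans ?_
    rw [Real.norm_of_nonneg (by positivity)]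
    gcongr
  exact hO.trans_isLittleO (Asymptotics.isLittleO_pow_id one_lt_two)

end Exponentials

/-! ### The potential -/

section Potential

lemma hasFDerivAt_ofReal_comp_im {g : ℝ → ℝ} {g' : ℝ} {z : ℂ} (hg : HasDerivAt g g' z.im) :
    HasFDerivAt (fun w : ℂ => ((g w.im : ℝ) : ℂ))
      (Complex.ofRealCLM.comp (g' • Complex.imCLM)) z :=
  Complex.ofRealCLM.hasFDerivAt.comp z (hg.comp_hasFDerivAt z Complex.imCLM.hasFDerivAt)

lemma wirtinger_ofReal_comp_im {g : ℝ → ℝ} {g' : ℝ} {z : ℂ} (hg : HasDerivAt g g' z.im) :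
    wirtinger (fun w : ℂ => ((g w.im : ℝ) : ℂ)) z = -Complex.I / 2 * g' := by
  rw [wirtinger, (hasFDerivAt_ofReal_comp_im hg).fderiv]
  simp
  ring

lemma wirtingerBar_const_mul_ofReal_comp_im {g : ℝ → ℝ} {g' : ℝ} {z : ℂ} (c : ℂ)
    (hg : HasDerivAt g g' z.im) :
    wirtingerBar (fun w : ℂ => c * ((g w.im : ℝ) : ℂ)) z = c * (Complex.I / 2 * g') := by
  rw [wirtingerBar, ((hasFDerivAt_ofReal_comp_im hg).const_mul c).fderiv]
  simp
  ring

variable {σ : Measure ℝ} {z : ℂ}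

lemma wirtinger_congr {f g : ℂ → ℂ} (h : f =ᶠ[𝓝 z] g) : wirtinger f z = wirtinger g z := by
  rw [wirtinger, wirtinger, h.fderiv_eq]

lemma wirtingerBar_congr {f g : ℂ → ℂ} (h : f =ᶠ[𝓝 z] g) :
    wirtingerBar f z = wirtingerBar g z := by
  rw [wirtingerBar, wirtingerBar, h.fderiv_eq]

lemma potential_eq (h0I : 0 ∈ interior (integrableExpSet id σ)) (hz : z ∈ halfStrip σ) :
    potential σ z = (cgf id σ (2 * z.im) : ℂ) := by
  rw [potential, charExt_sub_conj h0I ((mem_halfStrip_iff h0I).1 hz), ← Complex.ofReal_log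
    mgf_nonneg, cgf]

lemma contDiffOn_potential (h0I : 0 ∈ interior (integrableExpSet id σ)) :
    ContDiffOn ℝ (⊤ : ℕ∞) (potential σ) (halfStrip σ) := by
  refine ContDiffOn.congr (f := fun z => (cgf id σ (2 * z.im) : ℂ)) (fun z hz => ?_)
    fun z hz => potential_eq h0I hz
  refine ContDiffAt.contDiffWithinAt ?_
  have h1 : ContDiffAt ℝ (⊤ : ℕ∞) (cgf id σ) (2 * z.im) :=
    (analyticAt_cgf ((mem_halfStrip_iff h0I).1 hz)).contDiffAt
  have h2 : ContDiffAt ℝ (⊤ : ℕ∞) (fun w : ℂ => 2 * w.im) z :=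
    contDiffAt_const.mul Complex.imCLM.contDiff.contDiffAt
  have h3 : ContDiffAt ℝ (⊤ : ℕ∞) (fun w : ℂ => cgf id σ (2 * w.im)) z :=
    ContDiffAt.comp (g := cgf id σ) z h1 h2
  exact Complex.ofRealCLM.contDiff.comp_contDiffAt z h3

/-- On functions of `y = Im z`, `∂` is `-(i/2) d/dy` and `∂̄` is `(i/2) d/dy`; the halves cancel
against the argument `2y`. -/
lemma wirtingerBar_wirtinger_potential (h0I : 0 ∈ interior (integrableExpSet id σ))
    (hz : z ∈ halfStrip σ) :
    wirtingerBar (wirtinger (potential σ)) z = ((iteratedDeriv 2 (cgf id σ) (2 * z.im) : ℝ) : ℂ) := by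
  have hcomp : ∀ (g : ℝ → ℝ) (y : ℝ), DifferentiableAt ℝ g (2 * y) →
      HasDerivAt (fun y => g (2 * y)) (deriv g (2 * y) * 2) y := fun g y hg =>
    hg.hasDerivAt.comp y ((hasDerivAt_id y).const_mul 2 |>.congr_deriv (mul_one 2))
  have h1 : wirtinger (potential σ) =ᶠ[𝓝 z]
      fun w => -Complex.I * ((deriv (cgf id σ) (2 * w.im) : ℝ) : ℂ) := by
    filter_upwards [(isOpen_halfStrip h0I).mem_nhds hz] with w hw
    have hw' := analyticAt_cgf ((mem_halfStrip_iff h0I).1 hw)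
    have h2 : potential σ =ᶠ[𝓝 w] fun x => ((cgf id σ (2 * x.im) : ℝ) : ℂ) := by
      filter_upwards [(isOpen_halfStrip h0I).mem_nhds hw] with x hx using potential_eq h0I hx
    rw [wirtinger_congr h2, wirtinger_ofReal_comp_im (hcomp _ _ hw'.differentiableAt)]
    push_cast
    ring
  have hz' := (analyticAt_cgf ((mem_halfStrip_iff h0I).1 hz)).deriv
  rw [wirtingerBar_congr h1, wirtingerBar_const_mul_ofReal_comp_im _
    (hcomp _ _ hz'.differentiableAt), iteratedDeriv_succ, iteratedDeriv_one]
  push_cast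
  linear_combination (-((deriv (deriv (cgf id σ)) (2 * z.im) : ℝ) : ℂ)) * Complex.I_mul_I

lemma omegaForm_eq (h0I : 0 ∈ interior (integrableExpSet id σ)) (hz : z ∈ halfStrip σ) (u v : ℂ) :
    omegaForm σ z u v =
      ((-2 * (conj u * v).im * iteratedDeriv 2 (cgf id σ) (2 * z.im) : ℝ) : ℂ) := by
  rw [omegaForm, wirtingerBar_wirtinger_potential h0I hz]
  have h1 : conj u * v - conj v * u = (2 * (conj u * v).im : ℝ) * Complex.I := by
    rw [← Complex.sub_conj]
    simp [mul_comm]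
  rw [h1]
  push_cast
  linear_combination (((iteratedDeriv 2 (cgf id σ) (2 * z.im) : ℝ) : ℂ) * 2 * ((conj u * v).im : ℂ)) *
    Complex.I_mul_I

/-- The second derivative is the variance of `σ` tilted by `e^{tω}`, which vanishes only for a point
mass. -/
lemma iteratedDeriv_two_cgf_pos [IsProbabilityMeasure σ]
    (hne : ∀ κ : ℝ, ¬ ∀ᵐ ω ∂σ, ω = κ) {t : ℝ} (ht : t ∈ interior (integrableExpSet id σ)) :
    0 < iteratedDeriv 2 (cgf id σ) t := by
  rw [iteratedDeriv_two_cgf_eq_integral ht]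
  have hm : 0 < mgf id σ t := mgf_pos (interior_subset (s := integrableExpSet id σ) ht)
  refine div_pos ?_ hm
  set κ := deriv (cgf id σ) t
  have hnn : 0 ≤ fun ω : ℝ => (id ω - κ) ^ 2 * Real.exp (t * id ω) := fun ω => by
    simp only [Pi.zero_apply]; positivity
  have hint : Integrable (fun ω : ℝ => (id ω - κ) ^ 2 * Real.exp (t * id ω)) σ := by
    have h2 := integrable_pow_mul_exp_of_mem_interior_integrableExpSet ht 2
    have h1 := integrable_pow_mul_exp_of_mem_interior_integrableExpSet ht 1
    have h0 := integrable_pow_mul_exp_of_mem_interior_integrableExpSet ht 0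
    refine ((h2.sub (h1.const_mul (2 * κ))).add (h0.const_mul (κ ^ 2))).congr
      (Eventually.of_forall fun ω => ?_)
    simp only [Pi.add_apply, Pi.sub_apply]
    ring
  refine lt_of_le_of_ne (integral_nonneg hnn) fun h => hne κ ?_
  filter_upwards [(integral_eq_zero_iff_of_nonneg hnn hint).1 h.symm] with ω hω
  have := (mul_eq_zero.1 hω).resolve_right (Real.exp_pos _).ne'
  exact sub_eq_zero.1 (pow_eq_zero_iff two_ne_zero |>.1 this)

end Potential

/-! ### The Fubini-Study form along a holomorphic curve -/

section FubiniStudy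

variable {E : Type*} [NormedAddCommGroup E] [InnerProductSpace ℂ E]

/-- The value of `d` is irrelevant: the Fubini–Study form ignores tangent components along `c z`. -/
lemma hasDerivAt_affine {c : ℂ → E} {c' : E} {z : ℂ} (e : E) (hc : HasDerivAt c c' z)
    (he : inner ℂ e (c z) ≠ 0) :
    ∃ d : ℂ, HasDerivAt (fun x => (inner ℂ e (c x))⁻¹ • c x)
      ((inner ℂ e (c z))⁻¹ • c' + d • c z) z := by
  have h1 : HasDerivAt (fun x => inner ℂ e (c x)) (inner ℂ e c') z :=
    (innerSL ℂ e).hasFDerivAt.comp_hasDerivAt z hc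
  exact ⟨_, (h1.inv he).smul hc⟩

/-- The form is invariant under rescaling `w`, `ξ`, `η` together and under adding multiples of `w`
to `ξ` or `η`, so the chart vector `e` drops out. -/
lemma fubiniStudyPullback_eq {f : ℂ → ℙ ℂ E} {c : ℂ → E} {c' : E} {z : ℂ} (e : E)
    (hc : HasDerivAt c c' z) (he : inner ℂ e (c z) ≠ 0)
    (hf : (fun x => affineChart e (f x)) =ᶠ[𝓝 z] fun x => (inner ℂ e (c x))⁻¹ • c x) (u v : ℂ) :
    fubiniStudyPullback e f z u v = -2 * (conj u * v *
      ((inner ℂ c' c' * inner ℂ (c z) (c z) - inner ℂ c' (c z) * inner ℂ (c z) c') /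
        inner ℂ (c z) (c z) ^ 2)).im := by
  obtain ⟨d, hd⟩ := hasDerivAt_affine e hc he
  have hfd : ∀ u, fderiv ℝ (fun x => affineChart e (f x)) z u =
      u • ((inner ℂ e (c z))⁻¹ • c' + d • c z) := fun u => by
    rw [hf.fderiv_eq, (hd.hasFDerivAt.restrictScalars ℝ).fderiv]
    simp
  rw [fubiniStudyPullback, hfd, hfd, hf.eq_of_nhds, fubiniStudy]
  congr 2
  have hc0 : c z ≠ 0 := fun h => he (by rw [h, inner_zero_right])
  have hN : inner ℂ (c z) (c z) ≠ 0 := inner_self_ne_zero.2 hc0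
  have ha := inv_ne_zero he
  set a := (inner ℂ e (c z))⁻¹
  have hca : conj a ≠ 0 := (map_ne_zero _).2 ha
  have hnorm : ((‖a • c z‖ : ℝ) : ℂ) ^ 2 = conj a * a * inner ℂ (c z) (c z) := by
    have := inner_self_eq_norm_sq_to_K (𝕜 := ℂ) (a • c z)
    rw [inner_smul_left, inner_smul_right] at this
    rw [mul_assoc, this]
    rfl
  rw [show ((‖a • c z‖ : ℝ) : ℂ) ^ 4 = (((‖a • c z‖ : ℝ) : ℂ) ^ 2) ^ 2 by ring, hnorm]
  simp only [inner_smul_left, inner_smul_right, inner_add_left, inner_add_right]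
  generalize inner ℂ (c z) (c z) = N at *
  field_simp
  ring

end FubiniStudy

/-! ### The coherent states map -/

section Coherent

variable {P : ProjMeasure Fock} {z : ℂ}

instance isProbabilityMeasure_measure_ket_zero :
    IsProbabilityMeasure (P.measure (ket 0)) :=
  ⟨by rw [P.measure_univ, norm_ket]; simp⟩

/-- A point mass at `κ` would make `|0⟩` an eigenvector, whereas `H|0⟩` has a positive component on
`|1⟩`. -/
lemma not_ae_eq_const (hσ : HasPosLeading (P.fapply (fun ω => (ω : ℂ) ^ 1) (ket 0)) 1) (κ : ℝ) :
    ¬ ∀ᵐ ω ∂(P.measure (ket 0)), ω = κ := by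
  intro hκ
  have h1 : P.fapply (fun ω => (ω : ℂ) ^ 1) (ket 0) = (κ : ℂ) • ket 0 := by
    have h2 := ProjMeasure.fapply_indicator (P := P) MeasurableSet.univ (κ : ℂ) (ket 0)
    rw [Set.indicator_univ, P.proj_univ] at h2
    refine (ProjMeasure.fapply_congr_ae ?_).trans h2
    filter_upwards [hκ] with ω hω
    rw [hω, pow_one]
  obtain ⟨a, ha, h2⟩ := hσ.2
  have h3 : ((κ : ℂ) • ket 0 : Fock) 1 = κ * ket 0 1 := rfl
  rw [h1, h3, ket_apply, if_neg one_ne_zero, mul_zero] at h2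
  exact ha.ne (Complex.ofReal_injective h2)

variable (hU : ∀ n, P.cyclic (ket 0) (orthoPoly (P.measure (ket 0)) n) = ket n)
  (h0I : 0 ∈ interior (integrableExpSet id (P.measure (ket 0))))

include hU

lemma inner_coherent_self (hz : 2 * z.im ∈ interior (integrableExpSet id (P.measure (ket 0)))) :
    inner ℂ (coherent (P.measure (ket 0)) z) (coherent (P.measure (ket 0)) z) =
      (mgf id (P.measure (ket 0)) (2 * z.im) : ℂ) := by
  rw [coherent_eq_cyclic hU, LinearIsometry.inner_map_map, inner_expL2_self hz]

lemma coherent_ne_zero (hz : 2 * z.im ∈ interior (integrableExpSet id (P.measure (ket 0)))) :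
    coherent (P.measure (ket 0)) z ≠ 0 := by
  rw [← inner_self_ne_zero (𝕜 := ℂ), inner_coherent_self hU hz]
  exact_mod_cast (mgf_pos (interior_subset
    (s := integrableExpSet id (P.measure (ket 0))) hz)).ne'

lemma hasDerivAt_coherent
    (hz : 2 * z.im ∈ interior (integrableExpSet id (P.measure (ket 0)))) :
    HasDerivAt (coherent (P.measure (ket 0)))
      (P.cyclic (ket 0) (expL2Deriv (P.measure (ket 0)) z hz)) z := by
  have h1 : coherent (P.measure (ket 0)) =
      fun z => P.cyclic (ket 0) (expL2 (P.measure (ket 0)) z) :=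
    funext fun z => coherent_eq_cyclic hU z
  rw [h1]
  exact (P.cyclic (ket 0)).toContinuousLinearMap.hasFDerivAt.comp_hasDerivAt z (hasDerivAt_expL2 hz)

lemma evolution_coherent (hz : 2 * z.im ∈ interior (integrableExpSet id (P.measure (ket 0))))
    (t : ℝ) : P.evolution t (coherent (P.measure (ket 0)) z) =
      coherent (P.measure (ket 0)) (z + t) := by
  have hzt : 2 * (z + t).im ∈ interior (integrableExpSet id (P.measure (ket 0))) := by
    simpa using hz
  rw [coherent_eq_cyclic hU, coherent_eq_cyclic hU, expL2_eq hz, expL2_eq hzt,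
    ← ProjMeasure.fapply_of_memLp, ← ProjMeasure.fapply_of_memLp, ProjMeasure.evolution_apply,
    ProjMeasure.fapply_fapply (by fun_prop) (memLp_exp hz) (ProjMeasure.memLp_exp_evolution t _)]
  congr 1
  ext ω
  rw [Pi.mul_apply, ← Complex.exp_add]
  ring_nf

include h0I

lemma coherentProj_eq (hz : z ∈ halfStrip (P.measure (ket 0))) :
    coherentProj (P.measure (ket 0)) z = Projectivization.mk ℂ (coherent (P.measure (ket 0)) z)
      (coherent_ne_zero hU ((mem_halfStrip_iff h0I).1 hz)) :=
  dif_pos _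

lemma mem_chartDomain_iff (e : Fock) (hz : z ∈ halfStrip (P.measure (ket 0))) :
    coherentProj (P.measure (ket 0)) z ∈ chartDomain e ↔
      inner ℂ e (coherent (P.measure (ket 0)) z) ≠ 0 := by
  rw [coherentProj_eq hU h0I hz, mk_mem_chartDomain]

lemma affineChart_coherentProj (e : Fock) (hz : z ∈ halfStrip (P.measure (ket 0))) :
    affineChart e (coherentProj (P.measure (ket 0)) z) =
      (inner ℂ e (coherent (P.measure (ket 0)) z))⁻¹ • coherent (P.measure (ket 0)) z := by
  rw [coherentProj_eq hU h0I hz, affineChart_mk]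

lemma affineChart_coherentProj_eventuallyEq (e : Fock)
    (hz : z ∈ halfStrip (P.measure (ket 0))) :
    (fun x => affineChart e (coherentProj (P.measure (ket 0)) x)) =ᶠ[𝓝 z]
      fun x => (inner ℂ e (coherent (P.measure (ket 0)) x))⁻¹ • coherent (P.measure (ket 0)) x := by
  filter_upwards [(isOpen_halfStrip h0I).mem_nhds hz] with x hx
    using affineChart_coherentProj hU h0I e hx

lemma isHolomorphicToProj_coherentProj :
    IsHolomorphicToProj (coherentProj (P.measure (ket 0))) (halfStrip (P.measure (ket 0))) := by
  intro e
  refine ⟨isOpen_iff_mem_nhds.2 fun z hz => ?_, fun z hz => ?_⟩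
  · have hc := (hasDerivAt_coherent hU ((mem_halfStrip_iff h0I).1 hz.1)).continuousAt
    have h1 : ContinuousAt (fun x => inner ℂ e (coherent (P.measure (ket 0)) x)) z :=
      (innerSL ℂ e).continuous.continuousAt.comp hc
    filter_upwards [(isOpen_halfStrip h0I).mem_nhds hz.1,
      h1.eventually_ne ((mem_chartDomain_iff hU h0I e hz.1).1 hz.2)] with x hx hx'
      using ⟨hx, (mem_chartDomain_iff hU h0I e hx).2 hx'⟩
  · obtain ⟨d, hd⟩ := hasDerivAt_affine e
      (hasDerivAt_coherent hU ((mem_halfStrip_iff h0I).1 hz.1))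
      ((mem_chartDomain_iff hU h0I e hz.1).1 hz.2)
    exact (hd.congr_of_eventuallyEq (affineChart_coherentProj_eventuallyEq hU h0I e
      hz.1)).differentiableAt.differentiableWithinAt

lemma fubiniStudyPullback_coherentProj (e : Fock) (hz : z ∈ halfStrip (P.measure (ket 0)))
    (he : coherentProj (P.measure (ket 0)) z ∈ chartDomain e) (u v : ℂ) :
    (fubiniStudyPullback e (coherentProj (P.measure (ket 0))) z u v : ℂ) =
      omegaForm (P.measure (ket 0)) z u v := by
  have hz' := (mem_halfStrip_iff h0I).1 hz
  have hm := mgf_pos (interior_subset (s := integrableExpSet id (P.measure (ket 0))) hz')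
  rw [omegaForm_eq h0I hz, fubiniStudyPullback_eq e (hasDerivAt_coherent hU hz')
    ((mem_chartDomain_iff hU h0I e hz).1 he) (affineChart_coherentProj_eventuallyEq hU h0I e hz),
    inner_coherent_self hU hz', coherent_eq_cyclic hU, LinearIsometry.inner_map_map,
    LinearIsometry.inner_map_map, LinearIsometry.inner_map_map, inner_deriv_deriv,
    inner_deriv_expL2, inner_expL2_deriv, iteratedDeriv_two_cgf hz', deriv_cgf hz']
  simp only [id]
  set m₂ := ∫ ω, ω ^ 2 * Real.exp (2 * z.im * ω) ∂(P.measure (ket 0))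
  set m₁ := ∫ ω, ω * Real.exp (2 * z.im * ω) ∂(P.measure (ket 0))
  set m := mgf id (P.measure (ket 0)) (2 * z.im)
  -- The Gram determinant of `|z⟩` and its derivative, over `⟨z|z⟩²`, is the variance of the tilted
  -- measure.
  have h1 : ((m₂ : ℂ) * m - Complex.I * m₁ * (-Complex.I * m₁)) / (m : ℂ) ^ 2 =
      ((m₂ / m - (m₁ / m) ^ 2 : ℝ) : ℂ) := by
    have hm' : (m : ℂ) ≠ 0 := by exact_mod_cast hm.ne'
    push_cast
    field_simp
    linear_combination (m₁ : ℂ) ^ 2 * Complex.I_mul_I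
  rw [h1, Complex.im_mul_ofReal, mul_assoc]

end Coherent

end SpectralCoherent

end

/-! ### Assembly of the theorem. -/

open SpectralCoherent in
theorem mainTheorem3 (h b : ℕ → ℝ) (hb0 : b 0 = 0) (hb : ∀ n, 1 ≤ n → 0 < b n)
    (hdef : HasZeroDeficiencyIndices (jacobiOp h b))
    (P : ProjMeasure Fock) (hP : IsSpectralMeasureOf P (jacobiOp h b).closure)
    (σ : Measure ℝ) (hσ : σ = P.measure (ket 0))
    (hfin : ∀ n, absMoment σ n < ∞)
    (hlim : limsup (fun n : ℕ => absMoment σ n ^ (1 / (n : ℝ)) / (n : ℝ≥0∞)) atTop < ∞) :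
    -- the maximal strip exists
    (IsHolStrip σ (maxStrip σ) ∧ ∀ S, IsHolStrip σ S → S ⊆ maxStrip σ) ∧
    -- the coherent states are well defined and `U|z⟩ = e^{-iz·}`
    (∀ z ∈ halfStrip σ, MemLp (fun ω : ℝ => Complex.exp (-Complex.I * z * ω)) 2 σ ∧
      coherent σ z ≠ 0 ∧ toL2 σ (coherent σ z) = expL2 σ z) ∧
    -- `Ω` is well defined and nondegenerate on the half strip
    (∀ z ∈ halfStrip σ, 0 < (charExt σ (z - conj z)).re ∧ (charExt σ (z - conj z)).im = 0) ∧
    ContDiffOn ℝ (⊤ : ℕ∞) (potential σ) (halfStrip σ) ∧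
    (∀ z ∈ halfStrip σ, ∀ u : ℂ, u ≠ 0 → ∃ v : ℂ, omegaForm σ z u v ≠ 0) ∧
    -- `𝒦` is holomorphic
    IsOpen (halfStrip σ) ∧ IsHolomorphicToProj (coherentProj σ) (halfStrip σ) ∧
    -- the pullback of the Fubini-Study form is `Ω`
    (∀ z ∈ halfStrip σ, ∀ e : Fock, coherentProj σ z ∈ chartDomain e → ∀ u v : ℂ,
      (fubiniStudyPullback e (coherentProj σ) z u v : ℂ) = omegaForm σ z u v) ∧
    -- the diagram commutes
    (∀ t : ℝ, ∃ hinj : Function.Injective (P.evolution t).toLinearMap,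
      ∀ z ∈ halfStrip σ, z + t ∈ halfStrip σ ∧
        coherentProj σ (z + t) = Projectivization.map (P.evolution t).toLinearMap hinj
          (coherentProj σ z)) := by
  subst hσ
  have h0I := zero_mem_interior_integrableExpSet hfin hlim
  have hU := cyclic_orthoPoly hb hP hfin
  have hmem := fun z => mem_halfStrip_iff (z := z) h0I
  refine ⟨⟨?_, fun S hS => Set.subset_sUnion_of_mem hS⟩, fun z hz => ⟨memLp_exp ((hmem z).1 hz),
    coherent_ne_zero hU ((hmem z).1 hz), ?_⟩, fun z hz => ?_, contDiffOn_potential h0I,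
    -- The witness `iu` gives `Im(ū · iu) = |u|² > 0`.
    fun z hz u hu => ⟨Complex.I * u, ?_⟩, isOpen_halfStrip h0I,
    isHolomorphicToProj_coherentProj hU h0I, fun z hz e he u v =>
    fubiniStudyPullback_coherentProj hU h0I e hz he u v, fun t => ⟨P.evolution_injective t,
    fun z hz => ?_⟩⟩
  · rw [maxStrip_eq h0I]
    exact isHolStrip_im_preimage h0I
  · rw [coherent_eq_cyclic hU, toL2_cyclic hU]
  · rw [charExt_sub_conj h0I ((hmem z).1 hz), Complex.ofReal_re, Complex.ofReal_im]
    exact ⟨ProbabilityTheory.mgf_pos (interior_subset (s := ProbabilityTheory.integrableExpSet id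
      (P.measure (ket 0))) ((hmem z).1 hz)), rfl⟩
  · rw [omegaForm_eq h0I hz, Complex.ofReal_ne_zero]
    have h1 := iteratedDeriv_two_cgf_pos (not_ae_eq_const (hasPosLeading_fapply_pow hb hP hfin 1))
      ((hmem z).1 hz)
    have h2 : (conj u * (Complex.I * u)).im = Complex.normSq u := by
      rw [mul_left_comm, ← Complex.normSq_eq_conj_mul_self]
      simp
    rw [h2]
    have h3 := Complex.normSq_pos.2 hu
    exact (mul_neg_of_neg_of_pos (by linarith) h1).ne
  · have hzt : z + t ∈ halfStrip (P.measure (ket 0)) := by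
      rw [hmem] at hz ⊢
      simpa using hz
    refine ⟨hzt, ?_⟩
    rw [coherentProj_eq hU h0I hz, coherentProj_eq hU h0I hzt, Projectivization.map_mk]
    congr 1
    exact (evolution_coherent hU ((hmem z).1 hz) t).symm
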